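/- Write $\mathbb{R}_+^*=(0,\infty)$. Let $\mathscr H$ be the class of functions $F:(\mathbb{R}_+^*)^2\to\mathbb{R}_+^*$ that are continuous and nondecreasing in each coordinate, satisfy $F(ax,ay)=aF(x,y)$ for all $a,x,y>0$, and satisfy one of the following: * $F(x,y)\ge\max(x,y)$ for all $x,y>0$, and $\lim_{x\to0}F(x,y)=\lim_{x\to0}F(y,x)=y$ for all $y>0$ (then set $\varepsilon(F)=1$); * $F(x,y)\le\min(x,y)$ for all $x,y>0$, and $\lim_{x\to\infty}F(x,y)=\lim_{x\to\infty}F(y,x)=y$ for all $y>0$ (then set $\varepsilon(F)=-1$). For $F\in\mathscr H$ let $F^*=F$ if $\varepsilon(F)=1$ and $F^*(x,y)=1/F(1/x,1/y)$ if $\varepsilon(F)=-1$. For $t>0$, $a\ge0$ and $b>0$ let $$T_F(t)=\sup\{z\in\mathbb{R}:F^*(e^{-t},e^{-z})\ge1\}\in[0,\infty),\qquad \Gamma_F^{(a,b)}=\int_0^\infty t^a\,T_F(t)^b\,dt\in[0,\infty].$$ **Theorem 1.6.** Let $\mathbf F$ be a random function that almost surely belongs to $\mathscr H$, and let $(X_n)_{n\ge0}$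 be $\mathbb{R}_+^*$-valued random variables such that, for every $n\ge0$, $X_{n+1}$ has the same law as $\mathbf F(X_n,\widehat X_n)$, where $\widehat X_n$ is an independent copy of $X_n$ and $\mathbf F$ is independent of $(X_n,\widehat X_n)$; the law of $\mathbf F$ does not depend on $n$, and the law of $X_0$ is arbitrary. Assume that $\mathbb{P}(\mathbf F\notin\{\max,\min\})>0$, that $\mathbb{E}[\varepsilon(\mathbf F)]=0$ and $\mathbb{E}[\Gamma_{\mathbf F}^{(0,1)}\varepsilon(\mathbf F)]=0$, and that there is $\eta>0$ with $\mathbb{E}[\Gamma_{\mathbf F}^{(1+\eta,1)}]<\infty$ and $\mathbb{E}[\Gamma_{\mathbf F}^{(0,2+\eta)}]<\infty$. Then $$c_*:=\tfrac94\,\mathbb{E}\big[\Gamma_{\mathbf F}^{(0,2)}+2\,\Gamma_{\mathbf F}^{(1,1)}\big]\in(0,\infty),$$ and for all $y\in\mathbb{R}$, $$\lim_{n\to\infty}\mathbb{P}\Big(\frac{\log X_n}{(c_*n)^{1/3}}\le y\Big)=\int_{-\infty}^y\tfrac34(1-x^2)\,\mathbf 1_{\{|x|<1\}}\,dx.$$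 -/

import Mathlib

open MeasureTheory ProbabilityTheory Filter Topology

noncomputable section

namespace HomSystem

/-- The positive real half-line, with the order, topology, Borel sets, product and inverse
inherited from `ℝ`. -/
abbrev PosReal : Type := {x : ℝ // 0 < x}

/-- Functions of two positive real variables with positive real values. Random functions are
measurable for the product (cylinder) sigma-algebra on this type. -/
abbrev PosFun : Type := PosReal × PosReal → PosReal

/-- The exponential, as a map into the positive reals. -/
def pexp (x : ℝ) : PosReal := ⟨Real.exp x, Real.exp_pos x⟩

/-- `max`. -/
def phiPlus : PosFun := fun p => max p.1 p.2

/-- `min`. -/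
def phiMinus : PosFun := fun p => min p.1 p.2

/-- Continuous, nondecreasing in each coordinate, and homogeneous of degree one. -/
structure IsHomogeneous (F : PosFun) : Prop where
  continuous : Continuous F
  mono_left : ∀ y, Monotone fun x => F (x, y)
  mono_right : ∀ x, Monotone fun y => F (x, y)
  homogeneous : ∀ a x y, F (a * x, a * y) = a * F (x, y)

/-- Functions of the class that dominate `max`. The filter `comap Subtype.val (𝓝 0)` on the
positive reals expresses `x → 0`. -/
def classPlus : Set PosFun :=
  {F | IsHomogeneous F ∧ (∀ x y, max x y ≤ F (x, y)) ∧
    ∀ y : PosReal,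
      Tendsto (fun x : PosReal => F (x, y)) (comap Subtype.val (𝓝 (0 : ℝ))) (𝓝 y) ∧
      Tendsto (fun x : PosReal => F (y, x)) (comap Subtype.val (𝓝 (0 : ℝ))) (𝓝 y)}

/-- Functions of the class that are dominated by `min`. -/
def classMinus : Set PosFun :=
  {F | IsHomogeneous F ∧ (∀ x y, F (x, y) ≤ min x y) ∧
    ∀ y : PosReal,
      Tendsto (fun x : PosReal => F (x, y)) atTop (𝓝 y) ∧
      Tendsto (fun x : PosReal => F (y, x)) atTop (𝓝 y)}

/-- The class of 1-homogeneous functions under consideration. -/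
def classH : Set PosFun := classPlus ∪ classMinus

/-- The sign of a function of the class: `1` on `classPlus` and `-1` on `classMinus`. -/
def eps (F : PosFun) : ℝ :=
  classPlus.indicator (fun _ => 1) F - classMinus.indicator (fun _ => 1) F

/-- The conjugate of `F` by inversion, `(x, y) ↦ 1 / F (1 / x, 1 / y)`. -/
def inversion (F : PosFun) : PosFun := fun p => (F (p.1⁻¹, p.2⁻¹))⁻¹

open Classical in
/-- `F` itself if it dominates `max`, and its conjugate by inversion otherwise. -/
def starMap (F : PosFun) : PosFun := if F ∈ classPlus then F else inversion F

/-- `T_F(t) = sup {z ∈ ℝ : F*(e^{-t}, e^{-z}) ≥ 1}`. For `F` in the class and `t > 0` the set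
contains `0` and is bounded above. -/
def T (F : PosFun) (t : ℝ) : ℝ := sSup {z : ℝ | 1 ≤ (starMap F (pexp (-t), pexp (-z)) : ℝ)}

/-- The integral of `t ^ a * T_F(t) ^ b` over `t > 0`, with values in `[0, ∞]`. -/
def Gam (a b : ℝ) (F : PosFun) : ENNReal :=
  ∫⁻ t in Set.Ioi (0 : ℝ), ENNReal.ofReal (t ^ a * (T F t) ^ b)

/-- The constant `(9/4) E[Γ^{(0,2)} + 2 Γ^{(1,1)}]`, as an element of `[0, ∞]`. -/
def cstar {Ω : Type*} [MeasurableSpace Ω] (P : Measure Ω) (F : Ω → PosFun) : ENNReal :=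
  9 / 4 * ∫⁻ ω, (Gam 0 2 (F ω) + 2 * Gam 1 1 (F ω)) ∂P

/-- For every `n`, the law of `X (n + 1)` is that of `F (X n, X' n)`, where `X' n` is an
independent copy of `X n` and `F` is independent of `(X n, X' n)`. The independent triple is
realised on the product space. -/
def IsSystem {Ω Ω' : Type*} [MeasurableSpace Ω] [MeasurableSpace Ω'] (P : Measure Ω)
    (F : Ω → PosFun) (Q : Measure Ω') (X : ℕ → Ω' → PosReal) : Prop :=
  ∀ n, IdentDistrib (X (n + 1))
    (fun z : Ω × Ω' × Ω' => F z.1 (X n z.2.1, X n z.2.2)) Q (P.prod (Q.prod Q))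

/-- The density `(3/4) (1 - x²)` on `|x| < 1`, and `0` elsewhere. -/
def limitDensity (x : ℝ) : ℝ :=
  {x : ℝ | |x| < 1}.indicator (fun x => 3 / 4 * (1 - x ^ 2)) x

end HomSystem

end

/-! # The scaling limit of critical 1-homogeneous systems

In logarithmic coordinates, a function of the class becomes a map `g` of the plane that commutes
with diagonal translations and lies above `max` (sign `σ = 1`) or below `min` (`σ = -1`). If all
maps were `max` or `min`, balanced signs would leave the distribution function `u` of `log X`
unchanged: `(u² + 1 - (1 - u)²) / 2 = u`. The deviation from `max` and `min` is a short-range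
interaction, `-σ ∫ f (y - σ s) f (y - σ r) ds dr` for a density `f`, over the region `crossing` of
the pairs `(s, r)` with `0 < r ≤ T(s)` (`mem_crossing_iff`). Its leading term `f²` cancels by
criticality, and the next one gives the porous medium equation `∂ₜ u = m ∂ₓu ∂ₓₓu`, where `m` is the
mean of `s + r`. Its self-similar solution is the parabolic density on the scale `(9 m t / 2)^(1/3)`,
and `cstar = 9 m / 2` (`cstar_eq`).

Convergence follows from a comparison argument. The evolution is monotone and does not increase the
one-sided uniform distance: if `u ≥ V - e` for a distribution function `V` with density `f`, then
one step later `u ≥ V - e + (interaction of f)` (`IsLogMap.le_measureReal`,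
`IsRandomLogMap.le_measureReal_step`). To see this, the lowest part of mass `e` of the law `V` is
moved to `+∞`, a point whose mass the evolution with balanced signs preserves. The parabolic profile
solves the evolution up to an error `O(t^(-(p + 2) / 3))`, with `p > 1` provided by the moment
assumption, uniformly up to the edges of its support (`abs_bump_mul_bump_taylor`,
`IsRandomLogMap.exists_step_error`). These errors are summable. A profile which starts late, and
far enough to the right to be below the initial law up to a small error, therefore stays below the
law at all times up to a small error (`IsRandomLogMap.exists_profile_le`); shifts in space and time
do not affect the limit. The opposite bound is the same statement for the system conjugated by
`x ↦ -x`, which exchanges the signs and has the same crossing region. -/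

namespace HomSystem

/-! ### The parabolic profile -/

/-- The parabolic bump `(1 - x²)₊`. Three quarters of it is the limit density. -/
def bump (x : ℝ) : ℝ := max (1 - x ^ 2) 0

lemma bump_nonneg (x : ℝ) : 0 ≤ bump x := le_max_right _ _

lemma bump_le_one (x : ℝ) : bump x ≤ 1 :=
  max_le (by nlinarith [sq_nonneg x]) zero_le_one

lemma bump_neg (x : ℝ) : bump (-x) = bump x := by simp [bump]

lemma bump_of_one_le_abs {x : ℝ} (hx : 1 ≤ |x|) : bump x = 0 := by
  have : 1 ≤ x ^ 2 := (one_le_sq_iff_one_le_abs x).2 hx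
  exact max_eq_right (by linarith)

lemma bump_of_abs_le_one {x : ℝ} (hx : |x| ≤ 1) : bump x = 1 - x ^ 2 := by
  have : x ^ 2 ≤ 1 := (sq_le_one_iff_abs_le_one x).2 hx
  exact max_eq_left (by linarith)

@[fun_prop]
lemma continuous_bump : Continuous bump := by unfold bump; fun_prop

lemma bump_sub_le (x y : ℝ) : bump y - bump x ≤ 2 * |y - x| := by
  rcases le_total 1 |y| with hy | hy
  · rw [bump_of_one_le_abs hy]
    linarith [bump_nonneg x, abs_nonneg (y - x)]
  rw [bump_of_abs_le_one hy]
  rcases le_total 1 |x| with hx | hx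
  · rw [bump_of_one_le_abs hx]
    have h1 : 1 - |y| ≤ |y - x| := by
      have := abs_sub_abs_le_abs_sub x y
      rw [abs_sub_comm] at this
      linarith
    nlinarith [sq_abs y, abs_nonneg y]
  · rw [bump_of_abs_le_one hx]
    have h1 : |x + y| ≤ 2 := (abs_add_le x y).trans (by linarith)
    calc 1 - y ^ 2 - (1 - x ^ 2) = (x - y) * (x + y) := by ring
      _ ≤ |(x - y) * (x + y)| := le_abs_self _
      _ = |y - x| * |x + y| := by rw [abs_mul, abs_sub_comm]
      _ ≤ 2 * |y - x| := by nlinarith [abs_nonneg (y - x)]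

lemma abs_bump_sub_le (x y : ℝ) : |bump y - bump x| ≤ 2 * |y - x| := by
  rw [abs_le]
  have := bump_sub_le y x
  rw [abs_sub_comm] at this
  exact ⟨by linarith, bump_sub_le x y⟩

lemma abs_bump_sub_le_one (x y : ℝ) : |bump y - bump x| ≤ 1 := by
  rw [abs_le]
  constructor <;> linarith [bump_nonneg x, bump_nonneg y, bump_le_one x, bump_le_one y]

/-- The factor `bump x` compensates the jump of the derivative of `bump` at `±1`, so that the
first-order expansion has a quadratic error even across the edge of the support. -/
lemma bump_mul_taylor_sq (x a : ℝ) :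
    |bump x * (bump (x + a) - bump x + 2 * x * a)| ≤ 4 * a ^ 2 := by
  rcases le_total 1 |x| with hx | hx
  · rw [bump_of_one_le_abs hx]
    simp [sq_nonneg]
  rw [bump_of_abs_le_one hx]
  have hx2 : x ^ 2 ≤ 1 := (sq_le_one_iff_abs_le_one x).2 hx
  rcases le_total |x + a| 1 with h | h
  · rw [bump_of_abs_le_one h]
    have : (1 - x ^ 2) * (1 - (x + a) ^ 2 - (1 - x ^ 2) + 2 * x * a) = -((1 - x ^ 2) * a ^ 2) := by
      ring
    rw [this, abs_neg, abs_of_nonneg (mul_nonneg (by linarith) (sq_nonneg a))]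
    nlinarith [sq_nonneg a, sq_nonneg x]
  · rw [bump_of_one_le_abs h]
    have h1 : 1 ≤ (x + a) ^ 2 := (one_le_sq_iff_one_le_abs _).2 h
    have h2 : 1 - |x| ≤ |a| := by linarith [abs_add_le x a]
    have h3 : 1 - x ^ 2 ≤ 2 * |a| := by nlinarith [sq_abs x, abs_nonneg x]
    have h4 : x * a ≤ |a| := by
      calc x * a ≤ |x * a| := le_abs_self _
        _ = |x| * |a| := abs_mul _ _
        _ ≤ |a| := by nlinarith [abs_nonneg a]
    rw [abs_le]
    constructor
    · nlinarith [sq_nonneg a]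
    · have : (1 - x ^ 2) * (0 - (1 - x ^ 2) + 2 * x * a) ≤ (2 * |a|) * (2 * |a|) := by
        apply mul_le_mul_of_nonneg h3 _ (by linarith) (by positivity)
        linarith
      nlinarith [sq_abs a]

lemma bump_mul_taylor_linear (x a : ℝ) :
    |bump x * (bump (x + a) - bump x + 2 * x * a)| ≤ 4 * |a| := by
  rcases le_total 1 |x| with hx | hx
  · rw [bump_of_one_le_abs hx]
    simp
  have h1 := abs_bump_sub_le x (x + a)
  rw [add_sub_cancel_left] at h1
  have h2 : |2 * x * a| ≤ 2 * |a| := by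
    rw [abs_mul, abs_mul, abs_two]
    nlinarith [abs_nonneg a]
  rw [abs_mul, abs_of_nonneg (bump_nonneg x)]
  have h3 := abs_add_le (bump (x + a) - bump x) (2 * x * a)
  nlinarith [bump_le_one x, bump_nonneg x, abs_nonneg (bump (x + a) - bump x + 2 * x * a)]

/-- A quantity bounded both linearly and quadratically is bounded by all intermediate powers. -/
lemma le_mul_rpow_of_le_of_le_sq {A u m p : ℝ} (hm : 0 ≤ m) (hA : 0 ≤ A) (hp1 : 1 ≤ p)
    (hp2 : p ≤ 2) (h1 : u ≤ A * m) (h2 : u ≤ A * m ^ 2) : u ≤ A * m ^ p := by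
  rcases le_total m 1 with h | h
  · refine h2.trans (mul_le_mul_of_nonneg_left ?_ hA)
    rw [← Real.rpow_two]
    exact Real.rpow_le_rpow_of_exponent_ge' hm h (by linarith) hp2
  · refine h1.trans (mul_le_mul_of_nonneg_left ?_ hA)
    exact Real.self_le_rpow_of_one_le h hp1

lemma abs_bump_sub_mul_bump_sub_le (x a b p : ℝ) (hp1 : 1 ≤ p) (hp2 : p ≤ 2) :
    |(bump (x + a) - bump x) * (bump (x + b) - bump x)| ≤ 4 * (|a| ^ p + |b| ^ p) := by
  have ha := abs_bump_sub_le x (x + a)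
  have hb := abs_bump_sub_le x (x + b)
  have ha1 := abs_bump_sub_le_one x (x + a)
  have hb1 := abs_bump_sub_le_one x (x + b)
  rw [add_sub_cancel_left] at ha hb
  set m := max |a| |b| with hm
  have h0 : 0 ≤ m := (abs_nonneg a).trans (le_max_left _ _)
  have ham : |a| ≤ m := le_max_left _ _
  have hbm : |b| ≤ m := le_max_right _ _
  have key : |(bump (x + a) - bump x) * (bump (x + b) - bump x)| ≤ 4 * m ^ p := by
    rw [abs_mul]
    apply le_mul_rpow_of_le_of_le_sq h0 (by norm_num) hp1 hp2
    · nlinarith [abs_nonneg (bump (x + a) - bump x), abs_nonneg (bump (x + b) - bump x)]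
    · calc _ ≤ (2 * m) * (2 * m) := by
            apply mul_le_mul <;> first | positivity | linarith
        _ = 4 * m ^ 2 := by ring
  refine key.trans (mul_le_mul_of_nonneg_left ?_ (by norm_num))
  rcases max_choice |a| |b| with h | h <;> rw [hm, h]
  · linarith [Real.rpow_nonneg (abs_nonneg b) p]
  · linarith [Real.rpow_nonneg (abs_nonneg a) p]

/-- First-order expansion of `bump (x + a) * bump (x + b)`, with an error of any order
`p ∈ [1, 2]`, uniform in `x`. -/
lemma abs_bump_mul_bump_taylor (x a b p : ℝ) (hp1 : 1 ≤ p) (hp2 : p ≤ 2) :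
    |bump (x + a) * bump (x + b) - (bump x ^ 2 - 2 * x * bump x * (a + b))|
      ≤ 8 * (|a| ^ p + |b| ^ p) := by
  have one : ∀ a, |bump x * (bump (x + a) - bump x + 2 * x * a)| ≤ 4 * |a| ^ p := fun a =>
    le_mul_rpow_of_le_of_le_sq (abs_nonneg a) (by norm_num) hp1 hp2 (bump_mul_taylor_linear x a)
      (by rw [sq_abs]; exact bump_mul_taylor_sq x a)
  have split : bump (x + a) * bump (x + b) - (bump x ^ 2 - 2 * x * bump x * (a + b)) =
      (bump (x + a) - bump x) * (bump (x + b) - bump x)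
      + bump x * (bump (x + a) - bump x + 2 * x * a)
      + bump x * (bump (x + b) - bump x + 2 * x * b) := by ring
  rw [split]
  have h3 := abs_add_three ((bump (x + a) - bump x) * (bump (x + b) - bump x))
    (bump x * (bump (x + a) - bump x + 2 * x * a)) (bump x * (bump (x + b) - bump x + 2 * x * b))
  linarith [one a, one b, abs_bump_sub_mul_bump_sub_le x a b p hp1 hp2]

/-- The distribution function of the density `(3/4) (1 - x²)₊`. It is normalised by its value at
the origin, see `profile_of_le_neg_one` for the value at `-∞`. -/
noncomputable def profile (z : ℝ) : ℝ := 1 / 2 + ∫ x in (0 : ℝ)..z, 3 / 4 * bump x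

lemma profile_sub (z z' : ℝ) : profile z' - profile z = ∫ x in z..z', 3 / 4 * bump x := by
  have hint : ∀ a b : ℝ, IntervalIntegrable (fun x => 3 / 4 * bump x) volume a b := fun a b =>
    (by fun_prop : Continuous fun x => 3 / 4 * bump x).intervalIntegrable _ _
  rw [← intervalIntegral.integral_interval_sub_left (hint 0 z') (hint 0 z)]
  simp [profile]

lemma hasDerivAt_profile (z : ℝ) : HasDerivAt profile (3 / 4 * bump z) z := by
  have hc : Continuous fun x => 3 / 4 * bump x := by fun_prop
  exact (intervalIntegral.integral_hasDerivAt_right (hc.intervalIntegrable _ _)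
    hc.aestronglyMeasurable.stronglyMeasurableAtFilter hc.continuousAt).const_add _

@[fun_prop]
lemma continuous_profile : Continuous profile :=
  continuous_iff_continuousAt.2 fun z => (hasDerivAt_profile z).continuousAt

lemma profile_neg (z : ℝ) : profile (-z) = 1 - profile z := by
  have h := intervalIntegral.integral_comp_neg (a := 0) (b := z) (fun x => 3 / 4 * bump x)
  simp only [bump_neg, neg_zero] at h
  rw [profile, profile, intervalIntegral.integral_symm, ← h]
  ring

lemma profile_of_one_le {z : ℝ} (hz : 1 ≤ z) : profile z = 1 := by
  have h1 : profile 1 = 1 := by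
    have : ∫ x in (0 : ℝ)..1, 3 / 4 * bump x = ∫ x in (0 : ℝ)..1, 3 / 4 * (1 - x ^ 2) := by
      apply intervalIntegral.integral_congr
      intro x hx
      rw [Set.uIcc_of_le zero_le_one] at hx
      simp only
      rw [bump_of_abs_le_one (abs_le.2 ⟨by linarith [hx.1], hx.2⟩)]
    rw [profile, this, intervalIntegral.integral_const_mul, intervalIntegral.integral_sub
      (by simp) ((by fun_prop : Continuous fun x : ℝ => x ^ 2).intervalIntegrable _ _)]
    simp
    norm_num
  have h2 : profile z - profile 1 = 0 := by
    rw [profile_sub]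
    apply intervalIntegral.integral_zero_ae
    filter_upwards with x hx
    rw [Set.uIoc_of_le hz] at hx
    rw [bump_of_one_le_abs (hx.1.le.trans (le_abs_self x)), mul_zero]
  linarith

lemma profile_of_le_neg_one {z : ℝ} (hz : z ≤ -1) : profile z = 0 := by
  have := profile_neg z
  rw [profile_of_one_le (by linarith)] at this
  linarith

lemma monotone_profile : Monotone profile :=
  monotone_of_hasDerivAt_nonneg hasDerivAt_profile fun z => by
    have := bump_nonneg z
    simp only [Pi.zero_apply]
    positivity

lemma profile_nonneg (z : ℝ) : 0 ≤ profile z := by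
  have := monotone_profile (min_le_left z (-1))
  rwa [profile_of_le_neg_one (min_le_right z (-1))] at this

lemma profile_le_one (z : ℝ) : profile z ≤ 1 := by
  have := monotone_profile (le_max_left z 1)
  rwa [profile_of_one_le (le_max_right z 1)] at this

lemma profile_taylor (z z' : ℝ) :
    profile z' ≤ profile z + 3 / 4 * bump z * (z' - z) + 3 / 2 * (z' - z) ^ 2 := by
  have h := profile_sub z z'
  have hc : Continuous fun x => 3 / 4 * bump x - 3 / 4 * bump z := by fun_prop
  have h2 : ∫ x in z..z', (3 / 4 * bump x - 3 / 4 * bump z)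
      = (profile z' - profile z) - 3 / 4 * bump z * (z' - z) := by
    rw [intervalIntegral.integral_sub
      ((by fun_prop : Continuous fun x => 3 / 4 * bump x).intervalIntegrable _ _) (by simp), h]
    simp
    ring
  have h3 : ‖∫ x in z..z', (3 / 4 * bump x - 3 / 4 * bump z)‖ ≤ (3 / 2 * |z' - z|) * |z' - z| := by
    apply intervalIntegral.norm_integral_le_of_norm_le_const
    intro x hx
    have hx' : |x - z| ≤ |z' - z| :=
      Set.abs_sub_left_of_mem_uIcc (Set.uIoc_subset_uIcc hx)
    rw [← mul_sub, norm_mul, Real.norm_eq_abs, Real.norm_eq_abs, abs_of_pos (by norm_num)]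
    linarith [abs_bump_sub_le z x]
  rw [h2, Real.norm_eq_abs] at h3
  have := (abs_le.1 h3).2
  nlinarith [sq_abs (z' - z)]

/-- The effect on the profile of one unit of time: the scale at time `t` is proportional to
`t ^ (1 / 3)`. -/
lemma profile_time_step {t θ : ℝ} (z : ℝ) (ht : 1 ≤ t) (hθ : θ = (t / (t + 1)) ^ (1 / 3 : ℝ)) :
    profile (z * θ) ≤ profile z - z * bump z / (4 * t) + 1 / t ^ 2 := by
  have ht0 : 0 < t := by linarith
  have hθ1 : 1 - θ ≤ 1 / (3 * t) := by
    have h1 : (1 + 1 / t) ^ (1 / 3 : ℝ) ≤ 1 + 1 / 3 * (1 / t) :=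
      rpow_one_add_le_one_add_mul_self (by linarith [one_div_pos.2 ht0]) (by norm_num) (by norm_num)
    have h2 : θ = ((1 + 1 / t) ^ (1 / 3 : ℝ))⁻¹ := by
      rw [hθ, ← Real.inv_rpow (by positivity)]
      congr 1
      field_simp
    have h3 : (1 + 1 / 3 * (1 / t))⁻¹ ≤ θ := by
      rw [h2]
      exact inv_anti₀ (by positivity) h1
    have h4 : (1 + 1 / 3 * (1 / t))⁻¹ = 1 - 1 / (3 * t + 1) := by
      field_simp
      ring
    have h5 : 1 / (3 * t + 1) ≤ 1 / (3 * t) :=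
      one_div_le_one_div_of_le (by positivity) (by linarith)
    linarith
  have hθ2 : 1 / (3 * t) - 1 / (3 * t ^ 2) ≤ 1 - θ := by
    have h1 : (1 + -(1 / (t + 1))) ^ (1 / 3 : ℝ) ≤ 1 + 1 / 3 * -(1 / (t + 1)) := by
      apply rpow_one_add_le_one_add_mul_self _ (by norm_num) (by norm_num)
      rw [neg_le_neg_iff, div_le_one (by positivity)]
      linarith
    have h2 : t / (t + 1) = 1 + -(1 / (t + 1)) := by
      field_simp
      ring
    rw [← h2, ← hθ] at h1
    have h3 : 1 / (3 * t) - 1 / (3 * t ^ 2) ≤ 1 / 3 * (1 / (t + 1)) := by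
      have : 1 / 3 * (1 / (t + 1)) - (1 / (3 * t) - 1 / (3 * t ^ 2)) = 1 / (3 * t ^ 2 * (t + 1)) := by
        field_simp
        ring
      have : 0 < 1 / (3 * t ^ 2 * (t + 1)) := by positivity
      linarith
    linarith
  have hnonneg : 0 ≤ 1 - θ := by
    refine le_trans ?_ hθ2
    rw [sub_nonneg]
    exact one_div_le_one_div_of_le (by positivity) (by nlinarith)
  have hhalf : 1 / (3 * t) ≤ 1 / 2 := one_div_le_one_div_of_le (by norm_num) (by linarith)
  have hb0 := bump_nonneg z
  have hb1 := bump_le_one z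
  rcases le_total |z| 2 with hz | hz
  · have h := profile_taylor z (z * θ)
    have hzz : z ^ 2 ≤ 4 := by
      rw [← sq_abs]
      nlinarith [abs_nonneg z]
    have hq : (z * θ - z) ^ 2 ≤ 4 * (1 / (3 * t)) ^ 2 := by
      have : (z * θ - z) ^ 2 = z ^ 2 * (1 - θ) ^ 2 := by ring
      rw [this]
      apply mul_le_mul hzz _ (sq_nonneg _) (by norm_num)
      exact pow_le_pow_left₀ hnonneg hθ1 2
    have hzb : |z * bump z| ≤ 1 := by
      rcases le_total |z| 1 with h1 | h1
      · rw [abs_mul, abs_of_nonneg hb0]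
        nlinarith [abs_nonneg z]
      · simp [bump_of_one_le_abs h1]
    have hl : z * bump z * (1 / (3 * t) - (1 - θ)) ≤ 1 / (3 * t ^ 2) := by
      have h1 : 0 ≤ 1 / (3 * t) - (1 - θ) := by linarith
      have := (abs_le.1 hzb).2
      nlinarith
    have e1 : 3 / 4 * bump z * (z * θ - z) =
        - (z * bump z / (4 * t)) + 3 / 4 * (z * bump z * (1 / (3 * t) - (1 - θ))) := by
      field_simp
      ring
    have e2 : 3 / 4 * (1 / (3 * t ^ 2)) + 3 / 2 * (4 * (1 / (3 * t)) ^ 2) ≤ 1 / t ^ 2 := by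
      have : 3 / 4 * (1 / (3 * t ^ 2)) + 3 / 2 * (4 * (1 / (3 * t)) ^ 2) = 11 / 12 * (1 / t ^ 2) := by
        field_simp
        norm_num
      rw [this]
      nlinarith [show 0 < 1 / t ^ 2 by positivity]
    linarith
  · -- `z` and `z * θ` lie on the same side of the support
    rw [bump_of_one_le_abs (by linarith)]
    have hp : 0 < 1 / t ^ 2 := by positivity
    have hθh : 1 / 2 ≤ θ := by linarith
    rcases le_abs.1 hz with h | h
    · rw [profile_of_one_le (show 1 ≤ z by linarith)]
      simp only [mul_zero, zero_div]
      linarith [profile_le_one (z * θ)]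
    · rw [profile_of_le_neg_one (show z * θ ≤ -1 by nlinarith)]
      simp only [mul_zero, zero_div]
      linarith [profile_nonneg z]

lemma limitDensity_eq (x : ℝ) : limitDensity x = 3 / 4 * bump x := by
  rw [limitDensity, Set.indicator_apply]
  split_ifs with h
  · rw [bump_of_abs_le_one (le_of_lt h)]
  · rw [bump_of_one_le_abs (not_lt.1 h), mul_zero]

lemma hasCompactSupport_bump : HasCompactSupport bump :=
  HasCompactSupport.intro (isCompact_Icc (a := (-1 : ℝ)) (b := 1)) fun x hx =>
    bump_of_one_le_abs (by
      by_contra! h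
      exact hx (abs_le.1 h.le))

lemma integrable_bump : Integrable bump :=
  continuous_bump.integrable_of_hasCompactSupport hasCompactSupport_bump

lemma integral_Iic_limitDensity (y : ℝ) : ∫ x in Set.Iic y, limitDensity x = profile y := by
  simp_rw [limitDensity_eq]
  rw [integral_Iic_of_hasDerivAt_of_tendsto' (m := 0) (fun x _ => hasDerivAt_profile x)
    (integrable_bump.const_mul _).integrableOn, sub_zero]
  apply tendsto_const_nhds.congr'
  filter_upwards [eventually_le_atBot (-1 : ℝ)] with x hx
  rw [profile_of_le_neg_one hx]

/-- The density of the law of `K + ρ Z`, where `Z` has density `(3/4) (1 - x²)₊`. -/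
noncomputable def scaledDensity (K ρ : ℝ) (y : ℝ) : ℝ := 3 / 4 * ρ⁻¹ * bump ((y - K) / ρ)

/-- The law of `K + ρ Z`, where `Z` has density `(3/4) (1 - x²)₊`. -/
noncomputable def scaledLaw (K ρ : ℝ) : Measure ℝ :=
  volume.withDensity fun y => ENNReal.ofReal (scaledDensity K ρ y)

lemma scaledDensity_nonneg {ρ : ℝ} (hρ : 0 < ρ) (K y : ℝ) : 0 ≤ scaledDensity K ρ y :=
  mul_nonneg (by positivity) (bump_nonneg _)

lemma scaledDensity_le {ρ : ℝ} (hρ : 0 < ρ) (K y : ℝ) : scaledDensity K ρ y ≤ 3 / 4 * ρ⁻¹ :=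
  mul_le_of_le_one_right (by positivity) (bump_le_one _)

@[fun_prop]
lemma continuous_scaledDensity (K ρ : ℝ) : Continuous (scaledDensity K ρ) := by
  unfold scaledDensity; fun_prop

lemma integrable_scaledDensity {ρ : ℝ} (hρ : 0 < ρ) (K : ℝ) : Integrable (scaledDensity K ρ) :=
  ((integrable_bump.comp_div hρ.ne').comp_sub_right K).const_mul _

lemma scaledLaw_Iic {ρ : ℝ} (hρ : 0 < ρ) (K y : ℝ) :
    scaledLaw K ρ (Set.Iic y) = ENNReal.ofReal (profile ((y - K) / ρ)) := by
  have hd : ∀ x, HasDerivAt (fun x => profile ((x - K) / ρ)) (scaledDensity K ρ x) x := by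
    intro x
    refine ((hasDerivAt_profile ((x - K) / ρ)).comp x
      (((hasDerivAt_id x).sub_const K).div_const ρ)).congr_deriv ?_
    rw [scaledDensity]
    ring
  rw [scaledLaw, withDensity_apply _ measurableSet_Iic, ← ofReal_integral_eq_lintegral_ofReal
    (integrable_scaledDensity hρ K).integrableOn
    (ae_of_all _ fun x => scaledDensity_nonneg hρ K x),
    integral_Iic_of_hasDerivAt_of_tendsto' (m := 0) (fun x _ => hd x)
      (integrable_scaledDensity hρ K).integrableOn, sub_zero]
  apply tendsto_const_nhds.congr'
  filter_upwards [eventually_le_atBot (K - ρ)] with x hx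
  rw [profile_of_le_neg_one]
  rw [div_le_iff₀ hρ]
  linarith

lemma isProbabilityMeasure_scaledLaw {ρ : ℝ} (hρ : 0 < ρ) (K : ℝ) :
    IsProbabilityMeasure (scaledLaw K ρ) := by
  have h := tendsto_measure_Iic_atTop (scaledLaw K ρ)
  refine ⟨tendsto_nhds_unique h (tendsto_const_nhds.congr' ?_)⟩
  filter_upwards [eventually_ge_atTop (K + ρ)] with x hx
  rw [scaledLaw_Iic hρ, profile_of_one_le, ENNReal.ofReal_one]
  rw [le_div_iff₀ hρ]
  linarith

end HomSystem

namespace HomSystem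

/-! ### Comparison of product measures on monotone sets -/

section Comparison

variable {μ ν : Measure ℝ} [IsProbabilityMeasure μ] [IsProbabilityMeasure ν] {y₀ : ℝ}

lemma restrict_Ioi_le_of_isLowerSet (h : ∀ y, ν (Set.Iic y) ≤ μ (Set.Iic y) + ν (Set.Iic y₀))
    {S : Set ℝ} (hc : IsClosed S) (hl : IsLowerSet S) :
    ν.restrict (Set.Ioi y₀) S ≤ μ S := by
  rcases S.eq_empty_or_nonempty with rfl | hne
  · simp
  by_cases hb : BddAbove S
  · have hS : S = Set.Iic (sSup S) := by
      apply Set.Subset.antisymm (fun x hx => le_csSup hb hx)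
      exact hl.Iic_subset (hc.csSup_mem hne hb)
    rw [hS]
    set a := sSup S
    rw [Measure.restrict_apply measurableSet_Iic, ← ENNReal.add_le_add_iff_right
      (measure_ne_top ν (Set.Iic y₀)), ← measure_union _ measurableSet_Iic]
    · rcases le_total y₀ a with hy | hy
      · convert h a using 2
        ext x
        simp only [Set.mem_union, Set.mem_inter_iff, Set.mem_Iic, Set.mem_Ioi]
        grind
      · have : Set.Iic a ∩ Set.Ioi y₀ = ∅ := by
          ext x
          simp only [Set.mem_inter_iff, Set.mem_Iic, Set.mem_Ioi, Set.mem_empty_iff_false]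
          grind
        rw [this, Set.empty_union]
        exact le_add_self
    · rw [Set.disjoint_left]
      rintro x ⟨_, hx⟩ hx'
      exact (Set.mem_Iic.1 hx').not_gt hx
  · have hS : S = Set.univ := by
      rw [Set.eq_univ_iff_forall]
      intro x
      obtain ⟨z, hz, hxz⟩ := not_bddAbove_iff.1 hb x
      exact hl hxz.le hz
    rw [hS, measure_univ (μ := μ)]
    exact (Measure.restrict_apply_le _ _).trans prob_le_one

/-- If `μ` is stochastically smaller than the sub-probability `w = ν|(y₀, ∞)` completed by
an atom at `+∞`, then `μ ⊗ μ` gives more mass than `w ⊗ w` to sets that are lower in each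
coordinate. Points of `L` have all of `ℝ` as slice, and interact with the atom at `+∞`. -/
lemma prod_restrict_add_le_prod (h : ∀ y, ν (Set.Iic y) ≤ μ (Set.Iic y) + ν (Set.Iic y₀))
    {S : Set (ℝ × ℝ)} (hS : MeasurableSet S)
    (hl₁ : ∀ x', IsClosed {x | (x, x') ∈ S} ∧ IsLowerSet {x | (x, x') ∈ S})
    (hl₂ : ∀ x, IsClosed {x' | (x, x') ∈ S} ∧ IsLowerSet {x' | (x, x') ∈ S})
    {L : Set ℝ} (hLc : IsClosed L) (hLl : IsLowerSet L)
    (hL : ∀ x ∈ L, ∀ x', (x, x') ∈ S ∧ (x', x) ∈ S) :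
    ((ν.restrict (Set.Ioi y₀)).prod (ν.restrict (Set.Ioi y₀))) S
      + 2 * (ν (Set.Iic y₀) * ν.restrict (Set.Ioi y₀) L) ≤ (μ.prod μ) S := by
  set w := ν.restrict (Set.Ioi y₀) with hw
  set e := ν (Set.Iic y₀) with he
  have hcompl : w Set.univ + e = 1 := by
    rw [hw, Measure.restrict_apply_univ, he, ← measure_union _ measurableSet_Iic,
      Set.union_comm, Set.Iic_union_Ioi, measure_univ]
    rw [Set.disjoint_left]
    exact fun x hx hx' => (Set.mem_Iic.1 hx').not_gt hx
  -- one coordinate at a time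
  have slice : ∀ (A : Set ℝ) (x : ℝ), IsClosed A → IsLowerSet A → (x ∈ L → A = Set.univ) →
      w A + L.indicator (fun _ => e) x ≤ μ A := by
    intro A x hc hl hA
    by_cases hx : x ∈ L
    · rw [Set.indicator_of_mem hx, hA hx, hcompl, measure_univ]
    · rw [Set.indicator_of_notMem hx, add_zero]
      exact restrict_Ioi_le_of_isLowerSet h hc hl
  have hint : ∀ ρ : Measure ℝ, ∫⁻ x, L.indicator (fun _ => e) x ∂ρ = e * ρ L := fun ρ =>
    lintegral_indicator_const hLc.measurableSet e
  have step₁ : (w.prod w) S + e * w L ≤ (w.prod μ) S := by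
    rw [Measure.prod_apply hS, Measure.prod_apply hS, ← hint,
      ← lintegral_add_left (measurable_measure_prodMk_left hS)]
    apply lintegral_mono
    intro x
    exact slice _ x (hl₂ x).1 (hl₂ x).2 fun hx =>
      Set.eq_univ_iff_forall.2 fun x' => (hL x hx x').1
  have step₂ : (w.prod μ) S + e * μ L ≤ (μ.prod μ) S := by
    rw [Measure.prod_apply_symm hS, Measure.prod_apply_symm hS, ← hint,
      ← lintegral_add_left (measurable_measure_prodMk_right hS)]
    apply lintegral_mono
    intro x
    exact slice _ x (hl₁ x).1 (hl₁ x).2 fun hx =>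
      Set.eq_univ_iff_forall.2 fun x' => (hL x hx x').2
  have hwL : e * w L ≤ e * μ L := by
    apply mul_le_mul_right
    exact restrict_Ioi_le_of_isLowerSet h hLc hLl
  calc (w.prod w) S + 2 * (e * w L) = ((w.prod w) S + e * w L) + e * w L := by ring
    _ ≤ (w.prod μ) S + e * μ L := add_le_add step₁ hwL
    _ ≤ _ := step₂

/-! ### One step of the evolution for a fixed map -/

/-- A map of the plane that commutes with diagonal translations, is continuous and nondecreasing
in each coordinate, and lies above the maximum (`σ = 1`) or below the minimum (`σ = -1`). These
are the 1-homogeneous functions of the class, in logarithmic coordinates. -/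
structure IsLogMap (g : ℝ → ℝ → ℝ) (σ : ℝ) : Prop where
  continuous_left : ∀ x', Continuous fun x => g x x'
  continuous_right : ∀ x, Continuous fun x' => g x x'
  mono_left : ∀ x', Monotone fun x => g x x'
  mono_right : ∀ x, Monotone fun x' => g x x'
  add : ∀ c x x', g (c + x) (c + x') = c + g x x'
  sign : (σ = 1 ∧ ∀ x x', max x x' ≤ g x x') ∨ (σ = -1 ∧ ∀ x x', g x x' ≤ min x x')

/-- The pairs `(s, r)` of positive numbers such that `g` moves the pair `(-σ s, -σ r)`, which
lies on one side of the origin, to the other side. -/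
def crossing (g : ℝ → ℝ → ℝ) (σ : ℝ) : Set (ℝ × ℝ) :=
  {p | 0 < p.1 ∧ 0 < p.2 ∧ 0 ≤ σ * g (-(σ * p.1)) (-(σ * p.2))}

lemma IsLogMap.measurableSet_crossing {g : ℝ → ℝ → ℝ} {σ : ℝ}
    (hm : Measurable fun p : ℝ × ℝ => g p.1 p.2) : MeasurableSet (crossing g σ) := by
  have h1 : Measurable fun p : ℝ × ℝ => σ * g (-(σ * p.1)) (-(σ * p.2)) :=
    (hm.comp (by fun_prop : Measurable fun p : ℝ × ℝ => (-(σ * p.1), -(σ * p.2)))).const_mul σ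
  exact (measurableSet_lt measurable_const measurable_fst).inter
    ((measurableSet_lt measurable_const measurable_snd).inter (measurableSet_le measurable_const h1))

/-- In terms of distribution functions, restriction to `(y₀, ∞)` replaces `V` by `(V - e)₊`. -/
lemma measureReal_restrict_Ioi_Iic (ν : Measure ℝ) [IsProbabilityMeasure ν] (y₀ y : ℝ) :
    (ν.restrict (Set.Ioi y₀)).real (Set.Iic y)
      = max (ν.real (Set.Iic y) - ν.real (Set.Iic y₀)) 0 := by
  rw [measureReal_restrict_apply measurableSet_Iic]
  rcases le_total y₀ y with hy | hy
  · rw [max_eq_left (sub_nonneg.2 (measureReal_mono (Set.Iic_subset_Iic.2 hy))),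
      ← measureReal_sdiff (Set.Iic_subset_Iic.2 hy) measurableSet_Iic]
    congr 1
    ext x
    simp [and_comm]
  · rw [max_eq_right (sub_nonpos.2 (measureReal_mono (Set.Iic_subset_Iic.2 hy)))]
    have : Set.Iic y ∩ Set.Ioi y₀ = ∅ := by
      ext x
      simp only [Set.mem_inter_iff, Set.mem_Iic, Set.mem_Ioi, Set.mem_empty_iff_false]
      grind
    simp [this]

/-- Comparison in one step for a map above the maximum. The last term is the effect of `g` not
being the maximum. -/
lemma IsLogMap.le_measureReal_of_sign_one [NullSingletonClass ν] {g : ℝ → ℝ → ℝ} (hg : IsLogMap g 1)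
    (hm : Measurable fun p : ℝ × ℝ => g p.1 p.2)
    (h : ∀ y, ν (Set.Iic y) ≤ μ (Set.Iic y) + ν (Set.Iic y₀)) (y : ℝ) :
    (max (ν.real (Set.Iic y) - ν.real (Set.Iic y₀)) 0) ^ 2
      - (ν.prod ν).real {p | p.1 < y ∧ p.2 < y ∧ y < g p.1 p.2}
      ≤ (μ.prod μ).real {p | g p.1 p.2 ≤ y} := by
  set w := ν.restrict (Set.Ioi y₀) with hw
  have hS : MeasurableSet {p : ℝ × ℝ | g p.1 p.2 ≤ y} := measurableSet_le hm measurable_const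
  have h1 : (w.prod w) {p : ℝ × ℝ | g p.1 p.2 ≤ y} ≤ (μ.prod μ) {p | g p.1 p.2 ≤ y} := by
    have := prod_restrict_add_le_prod h hS (L := ∅)
      (fun x' => ⟨isClosed_le (hg.continuous_left x') continuous_const,
        fun a b hab ha => (hg.mono_left x' hab).trans ha⟩)
      (fun x => ⟨isClosed_le (hg.continuous_right x) continuous_const,
        fun a b hab ha => (hg.mono_right x hab).trans ha⟩)
      isClosed_empty (fun _ _ _ h => h) (fun _ h => h.elim)
    simpa using this
  have h2 : (w.prod w).real {p : ℝ × ℝ | g p.1 p.2 ≤ y} ≤ (μ.prod μ).real {p | g p.1 p.2 ≤ y} :=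
    ENNReal.toReal_mono (measure_ne_top _ _) h1
  have h3 : (w.prod w).real (Set.Iio y ×ˢ Set.Iio y)
      = (max (ν.real (Set.Iic y) - ν.real (Set.Iic y₀)) 0) ^ 2 := by
    rw [measureReal_prod_prod, measureReal_congr Iio_ae_eq_Iic, measureReal_restrict_Ioi_Iic, sq]
  have h4 : (w.prod w).real (Set.Iio y ×ˢ Set.Iio y) ≤
      (w.prod w).real {p | p.1 < y ∧ p.2 < y ∧ y < g p.1 p.2}
      + (w.prod w).real {p : ℝ × ℝ | g p.1 p.2 ≤ y} := by
    refine le_trans (measureReal_mono ?_) (measureReal_union_le _ _)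
    rintro ⟨a, b⟩ ⟨ha, hb⟩
    rcases le_or_gt (g a b) y with h | h
    · exact Or.inr h
    · exact Or.inl ⟨ha, hb, h⟩
  have h5 : (w.prod w).real {p | p.1 < y ∧ p.2 < y ∧ y < g p.1 p.2} ≤
      (ν.prod ν).real {p | p.1 < y ∧ p.2 < y ∧ y < g p.1 p.2} := by
    rw [hw, Measure.prod_restrict]
    exact ENNReal.toReal_mono (measure_ne_top _ _) (Measure.restrict_apply_le _ _)
  linarith

/-- Comparison in one step for a map below the minimum. -/
lemma IsLogMap.le_measureReal_of_sign_neg_one {g : ℝ → ℝ → ℝ} (hg : IsLogMap g (-1))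
    (hm : Measurable fun p : ℝ × ℝ => g p.1 p.2)
    (h : ∀ y, ν (Set.Iic y) ≤ μ (Set.Iic y) + ν (Set.Iic y₀)) (y : ℝ) :
    2 * (ν.real (Set.Iic y) - ν.real (Set.Iic y₀))
      - (max (ν.real (Set.Iic y) - ν.real (Set.Iic y₀)) 0) ^ 2
      + (ν.prod ν).real {p | y < p.1 ∧ y < p.2 ∧ g p.1 p.2 ≤ y}
      ≤ (μ.prod μ).real {p | g p.1 p.2 ≤ y} := by
  have hmin : ∀ x x', g x x' ≤ min x x' := by
    rcases hg.sign with h | h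
    · norm_num at h
    · exact h.2
  set w := ν.restrict (Set.Ioi y₀) with hw
  have hS : MeasurableSet {p : ℝ × ℝ | g p.1 p.2 ≤ y} := measurableSet_le hm measurable_const
  have h1 : (w.prod w) {p : ℝ × ℝ | g p.1 p.2 ≤ y} + 2 * (ν (Set.Iic y₀) * w (Set.Iic y))
      ≤ (μ.prod μ) {p | g p.1 p.2 ≤ y} :=
    prod_restrict_add_le_prod h hS
      (fun x' => ⟨isClosed_le (hg.continuous_left x') continuous_const,
        fun a b hab ha => (hg.mono_left x' hab).trans ha⟩)
      (fun x => ⟨isClosed_le (hg.continuous_right x) continuous_const,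
        fun a b hab ha => (hg.mono_right x hab).trans ha⟩)
      isClosed_Iic (isLowerSet_Iic y)
      (fun x hx x' => ⟨((hmin x x').trans (min_le_left _ _)).trans hx,
        ((hmin x' x).trans (min_le_right _ _)).trans hx⟩)
  have h2 : (w.prod w).real {p : ℝ × ℝ | g p.1 p.2 ≤ y}
      + 2 * (ν.real (Set.Iic y₀) * w.real (Set.Iic y)) ≤ (μ.prod μ).real {p | g p.1 p.2 ≤ y} := by
    have := ENNReal.toReal_mono (measure_ne_top _ _) h1
    rw [ENNReal.toReal_add (by finiteness) (by finiteness), ENNReal.toReal_mul,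
      ENNReal.toReal_mul] at this
    exact this
  have hQ : (ν.prod ν).real (Set.Ioi y ×ˢ Set.Ioi y) = (1 - ν.real (Set.Iic y)) ^ 2 := by
    rw [measureReal_prod_prod, ← Set.compl_Iic, probReal_compl_eq_one_sub measurableSet_Iic, sq]
  have hA : (w.prod w).real Set.univ = (1 - ν.real (Set.Iic y₀)) ^ 2 := by
    rw [← Set.univ_prod_univ, measureReal_prod_prod, hw, measureReal_restrict_apply_univ,
      ← Set.compl_Iic, probReal_compl_eq_one_sub measurableSet_Iic, sq]
  set R := {p : ℝ × ℝ | y < p.1 ∧ y < p.2 ∧ g p.1 p.2 ≤ y} with hR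
  have hRm : MeasurableSet R := (measurableSet_lt measurable_const measurable_fst).inter
    ((measurableSet_lt measurable_const measurable_snd).inter hS)
  have h3 : (w.prod w).real Set.univ ≤ (w.prod w).real {p : ℝ × ℝ | g p.1 p.2 ≤ y}
      + (w.prod w).real ((Set.Ioi y ×ˢ Set.Ioi y) \ R) := by
    refine le_trans (measureReal_mono ?_) (measureReal_union_le _ _)
    rintro ⟨a, b⟩ -
    rcases le_or_gt (g a b) y with h | h
    · exact Or.inl h
    · have := lt_min_iff.1 (h.trans_le (hmin a b))
      exact Or.inr ⟨⟨this.1, this.2⟩, fun hr => absurd hr.2.2 (not_le.2 h)⟩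
  have h4 : (w.prod w).real ((Set.Ioi y ×ˢ Set.Ioi y) \ R) ≤
      (ν.prod ν).real (Set.Ioi y ×ˢ Set.Ioi y) - (ν.prod ν).real R := by
    have hRQ : R ⊆ Set.Ioi y ×ˢ Set.Ioi y := fun p hp => ⟨hp.1, hp.2.1⟩
    rw [← measureReal_sdiff hRQ hRm, hw, Measure.prod_restrict]
    exact ENNReal.toReal_mono (measure_ne_top _ _) (Measure.restrict_apply_le _ _)
  rw [hw, measureReal_restrict_Ioi_Iic] at h2
  rw [hA] at h3
  rw [hQ] at h4
  have hV := measureReal_nonneg (μ := ν) (s := Set.Iic y)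
  have he := measureReal_nonneg (μ := ν) (s := Set.Iic y₀)
  rcases le_total (ν.real (Set.Iic y)) (ν.real (Set.Iic y₀)) with hc | hc
  · rw [max_eq_right (sub_nonpos.2 hc)] at h2 ⊢
    nlinarith
  · rw [max_eq_left (sub_nonneg.2 hc)] at h2 ⊢
    nlinarith

end Comparison

/-- Change of variables `x = y - σ s`, `x' = y - σ r` in the mass of a planar set. -/
lemma measureReal_prod_withDensity_eq {f : ℝ → ℝ} (hf : Measurable f) (hf0 : ∀ x, 0 ≤ f x)
    {σ : ℝ} (hσ : σ = 1 ∨ σ = -1) (y : ℝ) {R : Set (ℝ × ℝ)} (hR : MeasurableSet R) :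
    ((volume.withDensity fun x => ENNReal.ofReal (f x)).prod
      (volume.withDensity fun x => ENNReal.ofReal (f x))).real R =
    ∫ p in {p : ℝ × ℝ | (y - σ * p.1, y - σ * p.2) ∈ R}, f (y - σ * p.1) * f (y - σ * p.2) := by
  have hmp1 : MeasurePreserving (fun s : ℝ => y - σ * s) := by
    rcases hσ with rfl | rfl
    · simpa [Function.comp_def, ← sub_eq_add_neg] using
        (measurePreserving_add_left volume y).comp (Measure.measurePreserving_neg volume)
    · simpa [add_comm] using measurePreserving_add_left volume y
  have hmp : MeasurePreserving (fun p : ℝ × ℝ => (y - σ * p.1, y - σ * p.2)) := by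
    rw [Measure.volume_eq_prod]
    exact hmp1.prod hmp1
  have hfm : Measurable fun x => ENNReal.ofReal (f x) := hf.ennreal_ofReal
  rw [prod_withDensity hfm hfm, measureReal_def, withDensity_apply _ hR,
    ← Measure.volume_eq_prod, ← hmp.setLIntegral_comp_preimage hR (by fun_prop),
    integral_eq_lintegral_of_nonneg_ae]
  · simp_rw [ENNReal.ofReal_mul (hf0 _)]
    rfl
  · exact ae_of_all _ fun p => mul_nonneg (hf0 _) (hf0 _)
  · have : Measurable fun p : ℝ × ℝ => f (y - σ * p.1) * f (y - σ * p.2) := by fun_prop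
    exact this.aestronglyMeasurable

/-- One step of the evolution at fixed `g`: if `μ` dominates `V - e` on half-lines, where `V` is
the distribution function of a density `f`, then so does the law of `g` up to the explicit
interaction term. The two signs share one formula. -/
lemma IsLogMap.le_measureReal {g : ℝ → ℝ → ℝ} {σ : ℝ} (hg : IsLogMap g σ)
    (hm : Measurable fun p : ℝ × ℝ => g p.1 p.2)
    {μ : Measure ℝ} [IsProbabilityMeasure μ] {f : ℝ → ℝ} (hf : Measurable f)
    (hf0 : ∀ x, 0 ≤ f x) {ν : Measure ℝ} [IsProbabilityMeasure ν]
    (hν : ν = volume.withDensity fun x => ENNReal.ofReal (f x))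
    {y₀ : ℝ} (h : ∀ y, ν (Set.Iic y) ≤ μ (Set.Iic y) + ν (Set.Iic y₀)) (y : ℝ)
    (hint : IntegrableOn (fun p : ℝ × ℝ => f (y - σ * p.1) * f (y - σ * p.2)) (crossing g σ)) :
    (1 - σ) * (ν.real (Set.Iic y) - ν.real (Set.Iic y₀))
      + σ * (max (ν.real (Set.Iic y) - ν.real (Set.Iic y₀)) 0) ^ 2
      - σ * ∫ p in crossing g σ, f (y - σ * p.1) * f (y - σ * p.2)
      ≤ (μ.prod μ).real {p | g p.1 p.2 ≤ y} := by
  have hS : MeasurableSet {p : ℝ × ℝ | g p.1 p.2 ≤ y} := measurableSet_le hm measurable_const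
  have hS' : MeasurableSet {p : ℝ × ℝ | y < g p.1 p.2} := measurableSet_lt measurable_const hm
  rcases hg.sign with ⟨rfl, -⟩ | ⟨rfl, -⟩
  · have : NullSingletonClass ν := by rw [hν]; infer_instance
    have h1 := hg.le_measureReal_of_sign_one hm h y
    have h2 : (ν.prod ν).real {p | p.1 < y ∧ p.2 < y ∧ y < g p.1 p.2} ≤
        ∫ p in crossing g 1, f (y - 1 * p.1) * f (y - 1 * p.2) := by
      have hR : MeasurableSet {p : ℝ × ℝ | p.1 < y ∧ p.2 < y ∧ y < g p.1 p.2} :=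
        (measurableSet_lt measurable_fst measurable_const).inter
          ((measurableSet_lt measurable_snd measurable_const).inter hS')
      rw [hν, measureReal_prod_withDensity_eq hf hf0 (Or.inl rfl) y hR]
      apply setIntegral_mono_set hint (ae_of_all _ fun p => mul_nonneg (hf0 _) (hf0 _))
      apply LE.le.eventuallyLE
      rintro ⟨s, r⟩ ⟨h1, h2, h3⟩
      simp only [one_mul, sub_lt_self_iff] at h1 h2 h3
      refine ⟨h1, h2, ?_⟩
      have h4 := hg.add y (-s) (-r)
      simp only [← sub_eq_add_neg] at h4
      simp only [one_mul]
      linarith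
    linarith
  · have h1 := hg.le_measureReal_of_sign_neg_one hm h y
    have h2 : (ν.prod ν).real {p | y < p.1 ∧ y < p.2 ∧ g p.1 p.2 ≤ y} =
        ∫ p in crossing g (-1), f (y - (-1) * p.1) * f (y - (-1) * p.2) := by
      have hR : MeasurableSet {p : ℝ × ℝ | y < p.1 ∧ y < p.2 ∧ g p.1 p.2 ≤ y} :=
        (measurableSet_lt measurable_const measurable_fst).inter
          ((measurableSet_lt measurable_const measurable_snd).inter hS)
      rw [hν, measureReal_prod_withDensity_eq hf hf0 (Or.inr rfl) y hR]
      congr 2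
      ext ⟨s, r⟩
      have h4 := hg.add y s r
      simp only [crossing, Set.mem_ofPred_eq, neg_mul, one_mul, sub_neg_eq_add, neg_neg, h4,
        lt_add_iff_pos_right, Left.nonneg_neg_iff, add_le_iff_nonpos_right]
    linarith

end HomSystem

namespace HomSystem

/-! ### The averaged evolution -/

variable {Ω : Type*} [MeasurableSpace Ω]

/-- A random map `G ω` of sign `σ ω`, in logarithmic coordinates. -/
structure IsRandomLogMap (G : Ω → ℝ → ℝ → ℝ) (σ : Ω → ℝ) : Prop where
  measurable : Measurable fun z : Ω × ℝ × ℝ => G z.1 z.2.1 z.2.2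
  measurable_sign : Measurable σ
  isLogMap : ∀ ω, IsLogMap (G ω) (σ ω)

/-- The measure `P(dω) ds dr` on the triples with `(s, r)` in the crossing region of `G ω`.
All moments of the interaction are moments of `s` and `r` under this measure. -/
noncomputable def crossingMeasure (P : Measure Ω) (G : Ω → ℝ → ℝ → ℝ) (σ : Ω → ℝ) :
    Measure (Ω × ℝ × ℝ) :=
  (P.prod volume).restrict {z | z.2 ∈ crossing (G z.1) (σ z.1)}

/-- The interaction has mean zero at leading order, and moments of order `p ∈ (1, 2]`. -/
structure IsBalanced (P : Measure Ω) (G : Ω → ℝ → ℝ → ℝ) (σ : Ω → ℝ) (p : ℝ) : Prop where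
  one_lt : 1 < p
  le_two : p ≤ 2
  integral_sign : ∫ ω, σ ω ∂P = 0
  finite : IsFiniteMeasure (crossingMeasure P G σ)
  integral_crossing : ∫ z, σ z.1 ∂(crossingMeasure P G σ) = 0
  integrable_rpow : Integrable (fun z => z.2.1 ^ p + z.2.2 ^ p) (crossingMeasure P G σ)

namespace IsRandomLogMap

variable {P : Measure Ω} {G : Ω → ℝ → ℝ → ℝ} {σ : Ω → ℝ}

lemma sign_eq (h : IsRandomLogMap G σ) (ω : Ω) : σ ω = 1 ∨ σ ω = -1 :=
  (h.isLogMap ω).sign.imp And.left And.left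

lemma abs_sign (h : IsRandomLogMap G σ) (ω : Ω) : |σ ω| = 1 := by
  rcases h.sign_eq ω with h | h <;> simp [h]

lemma measurableSet_crossing (h : IsRandomLogMap G σ) :
    MeasurableSet {z : Ω × ℝ × ℝ | z.2 ∈ crossing (G z.1) (σ z.1)} := by
  have hs := h.measurable_sign
  have h1 : Measurable fun z : Ω × ℝ × ℝ =>
      σ z.1 * G z.1 (-(σ z.1 * z.2.1)) (-(σ z.1 * z.2.2)) :=
    (hs.comp measurable_fst).mul (h.measurable.comp (by fun_prop :
      Measurable fun z : Ω × ℝ × ℝ => (z.1, -(σ z.1 * z.2.1), -(σ z.1 * z.2.2))))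
  exact (measurableSet_lt measurable_const measurable_snd.fst).inter
    ((measurableSet_lt measurable_const measurable_snd.snd).inter
      (measurableSet_le measurable_const h1))

lemma ae_crossingMeasure (h : IsRandomLogMap G σ) :
    ∀ᵐ z ∂(crossingMeasure P G σ), 0 < z.2.1 ∧ 0 < z.2.2 := by
  filter_upwards [ae_restrict_mem h.measurableSet_crossing] with z hz
  exact ⟨hz.1, hz.2.1⟩

lemma integral_crossingMeasure [IsProbabilityMeasure P] (h : IsRandomLogMap G σ)
    {φ : Ω × ℝ × ℝ → ℝ}
    (hφ : Integrable φ (crossingMeasure P G σ)) :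
    Integrable (fun ω => ∫ q in crossing (G ω) (σ ω), φ (ω, q)) P ∧
    ∫ z, φ z ∂(crossingMeasure P G σ) = ∫ ω, (∫ q in crossing (G ω) (σ ω), φ (ω, q)) ∂P := by
  have hS := h.measurableSet_crossing
  set S := {z : Ω × ℝ × ℝ | z.2 ∈ crossing (G z.1) (σ z.1)} with hSdef
  have hI : Integrable (S.indicator φ) (P.prod volume) := (integrable_indicator_iff hS).2 hφ
  have hin : ∀ ω, ∫ q, S.indicator φ (ω, q) = ∫ q in crossing (G ω) (σ ω), φ (ω, q) := by
    intro ω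
    rw [← integral_indicator (IsLogMap.measurableSet_crossing
      (h.measurable.comp (measurable_prodMk_left (x := ω))))]
    rfl
  constructor
  · simpa only [hin] using hI.integral_prod_left
  · rw [crossingMeasure, ← integral_indicator hS, integral_prod _ hI]
    simp only [hin]

lemma integrable_fst_add_snd (h : IsRandomLogMap G σ) {p : ℝ} (hb : IsBalanced P G σ p) :
    Integrable (fun z => z.2.1 + z.2.2) (crossingMeasure P G σ) := by
  have := hb.finite
  refine ((integrable_const (2 : ℝ)).add hb.integrable_rpow).mono'
    (by fun_prop : Measurable fun z : Ω × ℝ × ℝ => z.2.1 + z.2.2).aestronglyMeasurable ?_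
  filter_upwards [h.ae_crossingMeasure] with z hz
  have key : ∀ x : ℝ, 0 < x → x ≤ 1 + x ^ p := by
    intro x hx
    rcases le_total x 1 with h1 | h1
    · linarith [Real.rpow_nonneg hx.le p]
    · linarith [Real.self_le_rpow_of_one_le h1 hb.one_lt.le]
  rw [Real.norm_of_nonneg (by linarith [hz.1, hz.2])]
  simp only [Pi.add_apply]
  linarith [key _ hz.1, key _ hz.2]

/-- The interaction term of the parabolic profile is integrable. -/
lemma integrable_interaction (h : IsRandomLogMap G σ) [IsFiniteMeasure (crossingMeasure P G σ)]
    {ρ : ℝ} (hρ : 0 < ρ) (K y : ℝ) :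
    Integrable (fun z => σ z.1 * (scaledDensity K ρ (y - σ z.1 * z.2.1)
      * scaledDensity K ρ (y - σ z.1 * z.2.2))) (crossingMeasure P G σ) := by
  have hs := h.measurable_sign
  have hf : Measurable (scaledDensity K ρ) := (continuous_scaledDensity K ρ).measurable
  apply Integrable.of_bound (C := (3 / 4 * ρ⁻¹) * (3 / 4 * ρ⁻¹))
  · apply Measurable.aestronglyMeasurable
    fun_prop
  · filter_upwards with z
    rw [norm_mul, Real.norm_eq_abs, h.abs_sign, one_mul, Real.norm_of_nonneg
      (mul_nonneg (scaledDensity_nonneg hρ _ _) (scaledDensity_nonneg hρ _ _))]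
    exact mul_le_mul (scaledDensity_le hρ _ _) (scaledDensity_le hρ _ _)
      (scaledDensity_nonneg hρ _ _) (by positivity)

/-- One step of the evolution, averaged: domination of the parabolic profile up to `e` is
propagated with the same `e`, up to the interaction term. -/
lemma le_measureReal_step [IsProbabilityMeasure P] (h : IsRandomLogMap G σ) {p : ℝ}
    (hb : IsBalanced P G σ p)
    {μ : Measure ℝ} [IsProbabilityMeasure μ] {K ρ e : ℝ} (hρ : 0 < ρ) (he0 : 0 ≤ e) (he1 : e ≤ 1)
    (hμ : ∀ y, profile ((y - K) / ρ) - e ≤ μ.real (Set.Iic y)) (y : ℝ) :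
    profile ((y - K) / ρ) - e - ∫ z, σ z.1 * (scaledDensity K ρ (y - σ z.1 * z.2.1)
      * scaledDensity K ρ (y - σ z.1 * z.2.2)) ∂(crossingMeasure P G σ)
      ≤ (P.prod (μ.prod μ)).real {z | G z.1 z.2.1 z.2.2 ≤ y} := by
  have hfin := hb.finite
  have hprob := isProbabilityMeasure_scaledLaw hρ K
  obtain ⟨z₀, -, hz₀⟩ : ∃ z₀ ∈ Set.Icc (-1 : ℝ) 1, profile z₀ = e := by
    apply intermediate_value_Icc (by norm_num) continuous_profile.continuousOn
    rw [profile_of_le_neg_one le_rfl, profile_of_one_le le_rfl]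
    exact ⟨he0, he1⟩
  have hreal : ∀ x, (scaledLaw K ρ).real (Set.Iic x) = profile ((x - K) / ρ) := fun x => by
    rw [measureReal_def, scaledLaw_Iic hρ, ENNReal.toReal_ofReal (profile_nonneg _)]
  have hy₀ : (scaledLaw K ρ).real (Set.Iic (K + ρ * z₀)) = e := by
    rw [hreal, ← hz₀]
    congr 1
    field_simp
    ring
  have hcomp : ∀ x, scaledLaw K ρ (Set.Iic x)
      ≤ μ (Set.Iic x) + scaledLaw K ρ (Set.Iic (K + ρ * z₀)) := by
    intro x
    rw [← ofReal_measureReal, ← ofReal_measureReal, ← ofReal_measureReal,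
      ← ENNReal.ofReal_add measureReal_nonneg measureReal_nonneg, hy₀, hreal]
    exact ENNReal.ofReal_le_ofReal (by linarith [hμ x])
  have hInt := h.integrable_interaction (P := P) hρ K y
  obtain ⟨hI1, hI2⟩ := h.integral_crossingMeasure hInt
  have hSm : MeasurableSet {z : Ω × ℝ × ℝ | G z.1 z.2.1 z.2.2 ≤ y} :=
    measurableSet_le h.measurable measurable_const
  have hσ : Integrable σ P := Integrable.of_bound h.measurable_sign.aestronglyMeasurable 1
    (ae_of_all _ fun ω => (h.abs_sign ω).le)
  have hR1 : Integrable (fun ω => (μ.prod μ).real {q | G ω q.1 q.2 ≤ y}) P := by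
    apply Integrable.of_bound (C := 1)
    · exact (measurable_measure_prodMk_left hSm).ennreal_toReal.aestronglyMeasurable
    · filter_upwards with ω
      rw [Real.norm_of_nonneg measureReal_nonneg]
      exact measureReal_le_one
  have hR2 : (P.prod (μ.prod μ)).real {z | G z.1 z.2.1 z.2.2 ≤ y}
      = ∫ ω, (μ.prod μ).real {q | G ω q.1 q.2 ≤ y} ∂P := by
    rw [measureReal_def, Measure.prod_apply hSm, ← integral_toReal
      (measurable_measure_prodMk_left hSm).aemeasurable (ae_of_all _ fun _ => measure_lt_top _ _)]
    rfl
  set V := profile ((y - K) / ρ)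
  set W := (max (V - e) 0) ^ 2
  have hAB : Integrable (fun ω => (V - e) + σ ω * (W - (V - e))) P :=
    (integrable_const _).add (hσ.mul_const _)
  have hL : ∫ ω, ((V - e) + σ ω * (W - (V - e)) - ∫ q in crossing (G ω) (σ ω),
      σ ω * (scaledDensity K ρ (y - σ ω * q.1) * scaledDensity K ρ (y - σ ω * q.2))) ∂P
      = V - e - ∫ z, σ z.1 * (scaledDensity K ρ (y - σ z.1 * z.2.1)
        * scaledDensity K ρ (y - σ z.1 * z.2.2)) ∂(crossingMeasure P G σ) := by
    rw [integral_sub hAB hI1, ← hI2,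
      integral_add (integrable_const _) (hσ.mul_const _), integral_mul_const, hb.integral_sign]
    simp
  rw [hR2, ← hL]
  refine integral_mono (hAB.sub hI1) hR1 fun ω => ?_
  have hne : -σ ω ≠ 0 := by rcases h.sign_eq ω with h | h <;> simp [h]
  have hf1 : Integrable fun s => scaledDensity K ρ (y - σ ω * s) := by
    have := ((integrable_scaledDensity hρ K).comp_add_left y).comp_mul_left' hne
    simpa [sub_eq_add_neg] using this
  have := (h.isLogMap ω).le_measureReal (h.measurable.comp (measurable_prodMk_left (x := ω)))
    (continuous_scaledDensity K ρ).measurable (scaledDensity_nonneg hρ K)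
    (ν := scaledLaw K ρ) rfl hcomp y
    (hf1.mul_prod hf1).integrableOn
  rw [hreal, hy₀] at this
  simp only
  rw [integral_const_mul]
  refine le_trans (le_of_eq ?_) this
  ring

/-- The interaction term of the parabolic profile, to first order in `1 / ρ`: the leading term
cancels because the interaction is balanced. -/
lemma integral_interaction_le (h : IsRandomLogMap G σ) {p : ℝ} (hb : IsBalanced P G σ p)
    {ρ : ℝ} (hρ : 0 < ρ) (K y : ℝ) :
    ∫ z, σ z.1 * (scaledDensity K ρ (y - σ z.1 * z.2.1)
      * scaledDensity K ρ (y - σ z.1 * z.2.2)) ∂(crossingMeasure P G σ)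
    ≤ 9 / 8 * ((y - K) / ρ * bump ((y - K) / ρ)) * (ρ ^ 3)⁻¹
        * ∫ z, (z.2.1 + z.2.2) ∂(crossingMeasure P G σ)
      + 9 / 2 * ρ ^ (-(2 + p)) * ∫ z, (z.2.1 ^ p + z.2.2 ^ p) ∂(crossingMeasure P G σ) := by
  have hfin := hb.finite
  set x := (y - K) / ρ with hx
  have hσ : Integrable (fun z : Ω × ℝ × ℝ => σ z.1) (crossingMeasure P G σ) :=
    Integrable.of_bound (h.measurable_sign.comp measurable_fst).aestronglyMeasurable 1
      (ae_of_all _ fun z => (h.abs_sign z.1).le)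
  have hI2 := h.integrable_fst_add_snd hb
  have hA : Integrable (fun z => σ z.1 * (9 / 16 * (ρ ^ 2)⁻¹ * bump x ^ 2))
      (crossingMeasure P G σ) := hσ.mul_const _
  have hB : Integrable (fun z => 9 / 8 * (x * bump x) * (ρ ^ 3)⁻¹ * (z.2.1 + z.2.2))
      (crossingMeasure P G σ) := hI2.const_mul _
  have hC : Integrable (fun z => 9 / 2 * ρ ^ (-(2 + p)) * (z.2.1 ^ p + z.2.2 ^ p))
      (crossingMeasure P G σ) := hb.integrable_rpow.const_mul _
  have hAB : Integrable (fun z => σ z.1 * (9 / 16 * (ρ ^ 2)⁻¹ * bump x ^ 2)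
      + 9 / 8 * (x * bump x) * (ρ ^ 3)⁻¹ * (z.2.1 + z.2.2)) (crossingMeasure P G σ) := hA.add hB
  have hR : ∫ z, (σ z.1 * (9 / 16 * (ρ ^ 2)⁻¹ * bump x ^ 2)
      + 9 / 8 * (x * bump x) * (ρ ^ 3)⁻¹ * (z.2.1 + z.2.2)
      + 9 / 2 * ρ ^ (-(2 + p)) * (z.2.1 ^ p + z.2.2 ^ p)) ∂(crossingMeasure P G σ)
      = 9 / 8 * (x * bump x) * (ρ ^ 3)⁻¹ * ∫ z, (z.2.1 + z.2.2) ∂(crossingMeasure P G σ)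
      + 9 / 2 * ρ ^ (-(2 + p)) * ∫ z, (z.2.1 ^ p + z.2.2 ^ p) ∂(crossingMeasure P G σ) := by
    rw [integral_add hAB hC, integral_add hA hB, integral_mul_const, integral_const_mul,
      integral_const_mul, hb.integral_crossing, zero_mul, zero_add]
  rw [← hR]
  refine integral_mono_ae (h.integrable_interaction hρ K y) (hAB.add hC) ?_
  filter_upwards [h.ae_crossingMeasure] with z ⟨hs, hr⟩
  generalize z.2.1 = s at hs
  generalize z.2.2 = r at hr
  have habs : ∀ s : ℝ, 0 < s → |-(σ z.1 * s / ρ)| ^ p = s ^ p * ρ ^ (-p) := by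
    intro s hs
    rw [abs_neg, abs_div, abs_mul, h.abs_sign, one_mul, abs_of_pos hs, abs_of_pos hρ,
      Real.div_rpow hs.le hρ.le, Real.rpow_neg hρ.le, div_eq_mul_inv]
  have hden : ∀ s, scaledDensity K ρ (y - σ z.1 * s)
      = 3 / 4 * ρ⁻¹ * bump (x + -(σ z.1 * s / ρ)) := by
    intro s
    rw [scaledDensity, hx]
    congr 2
    ring
  have hT := abs_bump_mul_bump_taylor x (-(σ z.1 * s / ρ)) (-(σ z.1 * r / ρ)) p hb.one_lt.le
    hb.le_two
  rw [habs s hs, habs r hr] at hT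
  set B := bump (x + -(σ z.1 * s / ρ)) * bump (x + -(σ z.1 * r / ρ)) with hBdef
  have hT2 : σ z.1 * B ≤ σ z.1 * bump x ^ 2 + 2 * x * bump x * ((s + r) / ρ)
      + 8 * (s ^ p * ρ ^ (-p) + r ^ p * ρ ^ (-p)) := by
    obtain ⟨h1, h2⟩ := abs_le.1 hT
    rcases h.sign_eq z.1 with h' | h' <;> rw [h'] at h1 h2 ⊢ <;> ring_nf at h1 h2 ⊢ <;> linarith
  have hpow : ρ ^ (-(2 + p)) = (ρ ^ 2)⁻¹ * ρ ^ (-p) := by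
    rw [neg_add, Real.rpow_add hρ, Real.rpow_neg hρ.le, Real.rpow_two]
  rw [hden s, hden r, hpow]
  calc σ z.1 * (3 / 4 * ρ⁻¹ * bump (x + -(σ z.1 * s / ρ)) *
        (3 / 4 * ρ⁻¹ * bump (x + -(σ z.1 * r / ρ))))
      = 9 / 16 * (ρ ^ 2)⁻¹ * (σ z.1 * B) := by rw [hBdef, ← inv_pow]; ring
    _ ≤ 9 / 16 * (ρ ^ 2)⁻¹ * (σ z.1 * bump x ^ 2 + 2 * x * bump x * ((s + r) / ρ)
      + 8 * (s ^ p * ρ ^ (-p) + r ^ p * ρ ^ (-p))) :=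
        mul_le_mul_of_nonneg_left hT2 (by positivity)
    _ = _ := by
        field_simp
        ring

/-! ### Convergence to the parabolic profile -/

/-- The parabolic profile solves the evolution up to an error of order `t ^ (-(p + 2) / 3)`,
which is summable. -/
lemma exists_step_error [IsProbabilityMeasure P] (h : IsRandomLogMap G σ) {p : ℝ}
    (hb : IsBalanced P G σ p) {m : ℝ}
    (hm : m = ∫ z, (z.2.1 + z.2.2) ∂(crossingMeasure P G σ)) (hm0 : 0 < m) :
    ∃ C : ℝ, 0 ≤ C ∧ ∀ (μ : Measure ℝ) [IsProbabilityMeasure μ] (K e t : ℝ), 0 ≤ e → e ≤ 1 →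
      1 ≤ t → (∀ y, profile ((y - K) / (9 / 2 * m * t) ^ (1 / 3 : ℝ)) - e ≤ μ.real (Set.Iic y)) →
      ∀ y, profile ((y - K) / (9 / 2 * m * (t + 1)) ^ (1 / 3 : ℝ))
        - (e + C * t ^ (-((p + 2) / 3)))
        ≤ (P.prod (μ.prod μ)).real {z | G z.1 z.2.1 z.2.2 ≤ y} := by
  set I := ∫ z, (z.2.1 ^ p + z.2.2 ^ p) ∂(crossingMeasure P G σ) with hI
  have hI0 : 0 ≤ I := by
    apply integral_nonneg_of_ae
    filter_upwards [h.ae_crossingMeasure] with z hz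
    exact add_nonneg (Real.rpow_nonneg hz.1.le p) (Real.rpow_nonneg hz.2.le p)
  refine ⟨1 + 9 / 2 * (9 / 2 * m) ^ (-((p + 2) / 3)) * I, by positivity, ?_⟩
  intro μ _ K e t he0 he1 ht hμ y
  have ht0 : 0 < t := by linarith
  have hct : 0 < 9 / 2 * m * t := by positivity
  set ρ := (9 / 2 * m * t) ^ (1 / 3 : ℝ) with hρdef
  have hρ : 0 < ρ := Real.rpow_pos_of_pos hct _
  have hρ3 : ρ ^ 3 = 9 / 2 * m * t := by
    rw [hρdef, ← Real.rpow_natCast, ← Real.rpow_mul hct.le]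
    norm_num
  have hρp : ρ ^ (-(2 + p)) = (9 / 2 * m) ^ (-((p + 2) / 3)) * t ^ (-((p + 2) / 3)) := by
    rw [hρdef, ← Real.rpow_mul hct.le, ← Real.mul_rpow (by positivity) ht0.le]
    congr 1
    ring
  have h1 := h.le_measureReal_step hb hρ he0 he1 hμ y
  have h2 := h.integral_interaction_le hb hρ K y
  rw [← hm, ← hI, hρ3, hρp] at h2
  set x := (y - K) / ρ with hx
  have h3 := profile_time_step x ht rfl
  have hθ : (y - K) / (9 / 2 * m * (t + 1)) ^ (1 / 3 : ℝ) = x * (t / (t + 1)) ^ (1 / 3 : ℝ) := by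
    have h1 : t / (t + 1) = (9 / 2 * m * t) / (9 / 2 * m * (t + 1)) := by
      rw [mul_div_mul_left _ _ (by positivity)]
    rw [hx, h1, Real.div_rpow hct.le (by positivity), ← hρdef]
    field_simp
  rw [hθ]
  have h4 : 9 / 8 * (x * bump x) * (9 / 2 * m * t)⁻¹ * m = x * bump x / (4 * t) := by
    field_simp
    ring
  have h5 : 1 / t ^ 2 ≤ t ^ (-((p + 2) / 3)) := by
    rw [one_div, ← Real.rpow_two, ← Real.rpow_neg ht0.le]
    exact Real.rpow_le_rpow_of_exponent_le ht (by linarith [hb.le_two])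
  rw [h4] at h2
  linarith

/-- Uniform lower bound: at all times, the law dominates a parabolic profile, shifted in space and
time, up to an arbitrarily small error. -/
lemma exists_profile_le [IsProbabilityMeasure P] (h : IsRandomLogMap G σ) {p : ℝ}
    (hb : IsBalanced P G σ p) {m : ℝ}
    (hm : m = ∫ z, (z.2.1 + z.2.2) ∂(crossingMeasure P G σ)) (hm0 : 0 < m)
    {μ : ℕ → Measure ℝ} [∀ n, IsProbabilityMeasure (μ n)]
    (hμ : ∀ n y, (μ (n + 1)).real (Set.Iic y)
      = (P.prod ((μ n).prod (μ n))).real {z | G z.1 z.2.1 z.2.2 ≤ y})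
    {δ : ℝ} (hδ : 0 < δ) (hδ1 : 2 * δ ≤ 1) :
    ∃ (K : ℝ) (N : ℕ), ∀ (n : ℕ) (y : ℝ),
      profile ((y - K) / (9 / 2 * m * (n + N : ℕ)) ^ (1 / 3 : ℝ)) - 2 * δ
        ≤ (μ n).real (Set.Iic y) := by
  obtain ⟨C, hC0, hC⟩ := h.exists_step_error hb hm hm0
  set a : ℕ → ℝ := fun k => C * (k : ℝ) ^ (-((p + 2) / 3)) with ha
  have ha0 : ∀ k, 0 ≤ a k := fun k => by positivity
  have hsum : Summable a :=
    (Real.summable_nat_rpow.2 (by linarith [hb.one_lt])).mul_left C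
  obtain ⟨N, hN1, hN⟩ : ∃ N : ℕ, 1 ≤ N ∧ ∑' k, a (k + N) ≤ δ := by
    have := (tendsto_sum_nat_add a).eventually (ge_mem_nhds hδ)
    obtain ⟨N, h1, h2⟩ := (this.and (eventually_ge_atTop 1)).exists
    exact ⟨N, h2, h1⟩
  have hpart : ∀ n, ∑ k ∈ Finset.range n, a (k + N) ≤ δ := fun n =>
    (((summable_nat_add_iff N).2 hsum).sum_le_tsum _ fun k _ => ha0 _).trans hN
  have hpart0 : ∀ n, 0 ≤ ∑ k ∈ Finset.range n, a (k + N) := fun n =>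
    Finset.sum_nonneg fun k _ => ha0 _
  obtain ⟨b, hb'⟩ : ∃ b, 1 - δ ≤ (μ 0).real (Set.Iic b) := by
    have h1 : Tendsto (fun b => (μ 0).real (Set.Iic b)) atTop (𝓝 1) := by
      have := (ENNReal.tendsto_toReal (measure_ne_top (μ 0) Set.univ)).comp
        (tendsto_measure_Iic_atTop (μ 0))
      simpa [Function.comp_def, measureReal_def] using this
    exact (h1.eventually (le_mem_nhds (by linarith : 1 - δ < 1))).exists
  set ρ := (9 / 2 * m * (N : ℝ)) ^ (1 / 3 : ℝ) with hρ
  have hNpos : (0 : ℝ) < N := by exact_mod_cast hN1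
  have hρ0 : 0 < ρ := by positivity
  -- the profile of time `N` vanishes to the left of `b`
  refine ⟨b + ρ, N, fun n y => ?_⟩
  have key : ∀ (n : ℕ) (y : ℝ),
      profile ((y - (b + ρ)) / (9 / 2 * m * (n + N : ℕ)) ^ (1 / 3 : ℝ))
        - (δ + ∑ k ∈ Finset.range n, a (k + N)) ≤ (μ n).real (Set.Iic y) := by
    intro n
    induction n with
    | zero =>
      intro y
      simp only [zero_add, Finset.range_zero, Finset.sum_empty, add_zero]
      rw [← hρ]
      rcases le_total y b with hy | hy
      · rw [profile_of_le_neg_one]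
        · linarith [measureReal_nonneg (μ := μ 0) (s := Set.Iic y)]
        · rw [div_le_iff₀ hρ0]
          linarith
      · have := measureReal_mono (μ := μ 0) (Set.Iic_subset_Iic.2 hy)
        linarith [profile_le_one ((y - (b + ρ)) / ρ)]
    | succ n ih =>
      intro y
      have h1 := hC (μ n) (b + ρ) (δ + ∑ k ∈ Finset.range n, a (k + N)) ((n + N : ℕ) : ℝ)
        (by linarith [hpart0 n]) (by linarith [hpart n])
        (by exact_mod_cast hN1.trans (Nat.le_add_left N n)) ih y
      rw [hμ, Finset.sum_range_succ]
      refine le_trans (le_of_eq ?_) h1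
      rw [show (n + 1 + N : ℕ) = (n + N) + 1 by ring, Nat.cast_add_one, add_assoc δ]
  linarith [key n y, hpart n]

lemma eventually_profile_le [IsProbabilityMeasure P] (h : IsRandomLogMap G σ) {p : ℝ}
    (hb : IsBalanced P G σ p) {m : ℝ}
    (hm : m = ∫ z, (z.2.1 + z.2.2) ∂(crossingMeasure P G σ)) (hm0 : 0 < m)
    {μ : ℕ → Measure ℝ} [∀ n, IsProbabilityMeasure (μ n)]
    (hμ : ∀ n y, (μ (n + 1)).real (Set.Iic y)
      = (P.prod ((μ n).prod (μ n))).real {z | G z.1 z.2.1 z.2.2 ≤ y})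
    (y : ℝ) {δ : ℝ} (hδ : 0 < δ) :
    ∀ᶠ n : ℕ in atTop, profile y - δ
      ≤ (μ n).real (Set.Iic (y * (9 / 2 * m * n) ^ (1 / 3 : ℝ))) := by
  obtain ⟨K, N, hK⟩ := h.exists_profile_le hb hm hm0 hμ (δ := min (δ / 4) (1 / 2))
    (by positivity) (by linarith [min_le_right (δ / 4) (1 / 2)])
  have hρ : Tendsto (fun n : ℕ => (9 / 2 * m * ((n + N : ℕ) : ℝ)) ^ (1 / 3 : ℝ)) atTop atTop :=
    (tendsto_rpow_atTop (by norm_num)).comp (Tendsto.const_mul_atTop (by positivity)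
      (tendsto_natCast_atTop_atTop.comp (tendsto_add_atTop_nat N)))
  have hratio : Tendsto (fun n : ℕ => (9 / 2 * m * (n : ℝ)) ^ (1 / 3 : ℝ)
      / (9 / 2 * m * ((n + N : ℕ) : ℝ)) ^ (1 / 3 : ℝ)) atTop (𝓝 1) := by
    have h1 : Tendsto (fun n : ℕ => ((n : ℝ) / ((n + N : ℕ) : ℝ)) ^ (1 / 3 : ℝ)) atTop (𝓝 1) := by
      have := (tendsto_natCast_div_add_atTop (N : ℝ)).rpow_const (p := (1 / 3 : ℝ))
        (Or.inl one_ne_zero)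
      simpa using this
    refine h1.congr fun n => ?_
    rw [← Real.div_rpow (by positivity) (by positivity)]
    congr 1
    rw [mul_div_mul_left _ _ (by positivity)]
  have hlim : Tendsto (fun n : ℕ => profile ((y * (9 / 2 * m * (n : ℝ)) ^ (1 / 3 : ℝ) - K)
      / (9 / 2 * m * ((n + N : ℕ) : ℝ)) ^ (1 / 3 : ℝ))) atTop (𝓝 (profile y)) := by
    apply (continuous_profile.tendsto y).comp
    have := (hratio.const_mul y).sub (hρ.const_div_atTop K)
    simp only [mul_one, sub_zero] at this
    refine this.congr fun n => ?_
    rw [sub_div, mul_div_assoc]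
  filter_upwards [hlim.eventually (le_mem_nhds (by linarith : profile y - δ / 2 < profile y))]
    with n hn
  have h1 := hK n (y * (9 / 2 * m * (n : ℝ)) ^ (1 / 3 : ℝ))
  linarith [min_le_left (δ / 4) (1 / 2)]

/-- Conjugation by `x ↦ -x` exchanges the two signs and preserves the crossing region. -/
lemma reflect (h : IsRandomLogMap G σ) :
    IsRandomLogMap (fun ω x x' => -G ω (-x) (-x')) (fun ω => -σ ω) where
  measurable := (h.measurable.comp (by fun_prop :
    Measurable fun z : Ω × ℝ × ℝ => (z.1, -z.2.1, -z.2.2))).neg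
  measurable_sign := h.measurable_sign.neg
  isLogMap ω :=
    { continuous_left := fun x' => (((h.isLogMap ω).continuous_left (-x')).comp continuous_neg).neg
      continuous_right := fun x => (((h.isLogMap ω).continuous_right (-x)).comp continuous_neg).neg
      mono_left := fun x' a b hab =>
        neg_le_neg ((h.isLogMap ω).mono_left (-x') (neg_le_neg hab))
      mono_right := fun x a b hab =>
        neg_le_neg ((h.isLogMap ω).mono_right (-x) (neg_le_neg hab))
      add := fun c x x' => by
        simp only [neg_add, (h.isLogMap ω).add]
        ring
      sign := by
        rcases (h.isLogMap ω).sign with ⟨h1, h2⟩ | ⟨h1, h2⟩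
        · refine Or.inr ⟨by rw [h1], fun x x' => ?_⟩
          have := h2 (-x) (-x')
          rw [max_neg_neg] at this
          linarith
        · refine Or.inl ⟨by rw [h1, neg_neg], fun x x' => ?_⟩
          have := h2 (-x) (-x')
          rw [min_neg_neg] at this
          linarith }

lemma crossingMeasure_reflect :
    crossingMeasure P (fun ω x x' => -G ω (-x) (-x')) (fun ω => -σ ω) = crossingMeasure P G σ := by
  simp [crossingMeasure, crossing]

lemma _root_.HomSystem.IsBalanced.reflect {p : ℝ} (hb : IsBalanced P G σ p) :
    IsBalanced P (fun ω x x' => -G ω (-x) (-x')) (fun ω => -σ ω) p where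
  one_lt := hb.one_lt
  le_two := hb.le_two
  integral_sign := by rw [integral_neg, hb.integral_sign, neg_zero]
  finite := by rw [crossingMeasure_reflect]; exact hb.finite
  integral_crossing := by
    rw [crossingMeasure_reflect, integral_neg, hb.integral_crossing, neg_zero]
  integrable_rpow := by rw [crossingMeasure_reflect]; exact hb.integrable_rpow

/-- Convergence of the rescaled laws to the parabolic profile. The upper bound is the lower bound
for the reflected system. -/
theorem tendsto_measureReal_Iic [IsProbabilityMeasure P] (h : IsRandomLogMap G σ) {p : ℝ}
    (hb : IsBalanced P G σ p) {m : ℝ}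
    (hm : m = ∫ z, (z.2.1 + z.2.2) ∂(crossingMeasure P G σ)) (hm0 : 0 < m)
    {μ : ℕ → Measure ℝ} [∀ n, IsProbabilityMeasure (μ n)]
    (hμ : ∀ n, μ (n + 1)
      = (P.prod ((μ n).prod (μ n))).map fun z => G z.1 z.2.1 z.2.2) (y : ℝ) :
    Tendsto (fun n : ℕ => (μ n).real (Set.Iic (y * (9 / 2 * m * n) ^ (1 / 3 : ℝ)))) atTop
      (𝓝 (profile y)) := by
  have hμ1 : ∀ n y, (μ (n + 1)).real (Set.Iic y)
      = (P.prod ((μ n).prod (μ n))).real {z | G z.1 z.2.1 z.2.2 ≤ y} := by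
    intro n y
    rw [hμ, map_measureReal_apply h.measurable measurableSet_Iic]
    rfl
  set μ' : ℕ → Measure ℝ := fun n => (μ n).map Neg.neg with hμ'
  have hprob : ∀ n, IsProbabilityMeasure (μ' n) := fun n =>
    Measure.isProbabilityMeasure_map measurable_neg.aemeasurable
  have hμ2 : ∀ n y, (μ' (n + 1)).real (Set.Iic y)
      = (P.prod ((μ' n).prod (μ' n))).real {z | -G z.1 (-z.2.1) (-z.2.2) ≤ y} := by
    intro n y
    have hmp : MeasurePreserving (fun z : Ω × ℝ × ℝ => (z.1, -z.2.1, -z.2.2))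
        (P.prod ((μ n).prod (μ n))) (P.prod ((μ' n).prod (μ' n))) := by
      have h1 : MeasurePreserving (fun x : ℝ => -x) (μ n) (μ' n) := ⟨measurable_neg, rfl⟩
      exact (MeasurePreserving.id P).prod (h1.prod h1)
    have hSm : MeasurableSet {z : Ω × ℝ × ℝ | -G z.1 (-z.2.1) (-z.2.2) ≤ y} :=
      measurableSet_le h.reflect.measurable measurable_const
    rw [← hmp.measureReal_preimage hSm.nullMeasurableSet, hμ',
      map_measureReal_apply measurable_neg measurableSet_Iic, hμ,
      map_measureReal_apply h.measurable (measurable_neg measurableSet_Iic)]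
    congr 1
    ext z
    simp [neg_le]
  rw [Metric.tendsto_atTop']
  intro ε hε
  -- room to pass from open to closed half-lines
  obtain ⟨y', hy', hyp⟩ : ∃ y', y < y' ∧ profile y' < profile y + ε / 2 := by
    have h1 : ∀ᶠ x in 𝓝[>] y, profile x < profile y + ε / 2 :=
      (continuous_profile.tendsto y).mono_left nhdsWithin_le_nhds |>.eventually
        (gt_mem_nhds (by linarith))
    obtain ⟨x, h2, h3⟩ := (h1.and self_mem_nhdsWithin).exists
    exact ⟨x, h3, h2⟩
  have hm' : m = ∫ z, (z.2.1 + z.2.2)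
      ∂(crossingMeasure P (fun ω x x' => -G ω (-x) (-x')) (fun ω => -σ ω)) := by
    rw [crossingMeasure_reflect, hm]
  have e1 := h.eventually_profile_le hb hm hm0 hμ1 y (half_pos hε)
  have e2 := h.reflect.eventually_profile_le hb.reflect hm' hm0 hμ2 (-y') (half_pos hε)
  obtain ⟨N, hN⟩ := eventually_atTop.1 (e1.and (e2.and (eventually_gt_atTop 0)))
  refine ⟨N, fun n hn => ?_⟩
  obtain ⟨h1, h2, h3⟩ := hN n hn.le
  set ρ := (9 / 2 * m * (n : ℝ)) ^ (1 / 3 : ℝ) with hρ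
  have hρ0 : 0 < ρ := by
    have : (0 : ℝ) < n := by exact_mod_cast h3
    positivity
  have h4 : (μ' n).real (Set.Iic (-y' * ρ)) ≤ 1 - (μ n).real (Set.Iic (y * ρ)) := by
    rw [hμ', map_measureReal_apply measurable_neg measurableSet_Iic,
      ← probReal_compl_eq_one_sub measurableSet_Iic]
    refine measureReal_mono ?_ (measure_ne_top _ _)
    intro x hx
    simp only [Set.mem_preimage, Set.mem_Iic, Set.mem_compl_iff, not_le] at hx ⊢
    nlinarith
  rw [profile_neg] at h2
  rw [Real.dist_eq, abs_lt]
  constructor <;> linarith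

end IsRandomLogMap

end HomSystem

namespace HomSystem

/-! ### Homogeneous functions in logarithmic coordinates -/

/-- `F` in logarithmic coordinates: `(x, x') ↦ log F (e^x, e^x')`. -/
noncomputable def logMap (F : PosFun) (x x' : ℝ) : ℝ := Real.log (F (pexp x, pexp x') : ℝ)

lemma exp_logMap (F : PosFun) (x x' : ℝ) : Real.exp (logMap F x x') = F (pexp x, pexp x') :=
  Real.exp_log (F _).2

@[fun_prop]
lemma continuous_pexp : Continuous pexp := Real.continuous_exp.subtype_mk _

lemma monotone_pexp : Monotone pexp := fun _ _ h => Real.exp_le_exp.2 h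

lemma pexp_add (c x : ℝ) : pexp (c + x) = pexp c * pexp x := Subtype.ext (Real.exp_add c x)

lemma pexp_neg (x : ℝ) : pexp (-x) = (pexp x)⁻¹ := Subtype.ext (Real.exp_neg x)

lemma pexp_log (x : PosReal) : pexp (Real.log (x : ℝ)) = x := Subtype.ext (Real.exp_log x.2)

lemma coe_max (x y : PosReal) : ((max x y : PosReal) : ℝ) = max (x : ℝ) y :=
  Subtype.mono_coe _ |>.map_max

lemma coe_min (x y : PosReal) : ((min x y : PosReal) : ℝ) = min (x : ℝ) y :=
  Subtype.mono_coe _ |>.map_min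

lemma IsHomogeneous.continuous_logMap {F : PosFun} (hF : IsHomogeneous F) :
    Continuous fun q : ℝ × ℝ => logMap F q.1 q.2 := by
  have h := hF.continuous
  apply Continuous.log
  · exact continuous_subtype_val.comp (h.comp (by fun_prop))
  · exact fun q => (F _).2.ne'

lemma disjoint_classPlus_classMinus : Disjoint classPlus classMinus := by
  rw [Set.disjoint_left]
  intro F h1 h2
  have h3 := (h1.2.1 (pexp 0) (pexp 1)).trans (h2.2.1 (pexp 0) (pexp 1))
  have h4 : pexp 1 ≤ pexp 0 := (le_max_right _ _).trans (h3.trans (min_le_left _ _))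
  have := Real.exp_le_exp.1 h4
  norm_num at this

lemma eps_of_mem_classPlus {F : PosFun} (h : F ∈ classPlus) : eps F = 1 := by
  rw [eps, Set.indicator_of_mem h, Set.indicator_of_notMem
    (Set.disjoint_left.1 disjoint_classPlus_classMinus h), sub_zero]

lemma eps_of_mem_classMinus {F : PosFun} (h : F ∈ classMinus) : eps F = -1 := by
  rw [eps, Set.indicator_of_mem h, Set.indicator_of_notMem
    (Set.disjoint_right.1 disjoint_classPlus_classMinus h), zero_sub]

lemma isHomogeneous_of_mem_classH {F : PosFun} (h : F ∈ classH) : IsHomogeneous F :=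
  h.elim And.left And.left

lemma isLogMap_logMap {F : PosFun} (h : F ∈ classH) : IsLogMap (logMap F) (eps F) := by
  have hF := isHomogeneous_of_mem_classH h
  refine ⟨fun x' => hF.continuous_logMap.comp (by fun_prop : Continuous fun x : ℝ => (x, x')),
    fun x => hF.continuous_logMap.comp (by fun_prop : Continuous fun x' : ℝ => (x, x')),
    fun x' a b hab => Real.log_le_log (F _).2 (hF.mono_left _ (monotone_pexp hab)),
    fun x a b hab => Real.log_le_log (F _).2 (hF.mono_right _ (monotone_pexp hab)), ?_, ?_⟩
  · intro c x x'
    rw [← Real.exp_eq_exp, Real.exp_add, exp_logMap, exp_logMap, pexp_add, pexp_add,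
      hF.homogeneous]
    rfl
  · rcases h with h | h
    · refine Or.inl ⟨eps_of_mem_classPlus h, fun x x' => ?_⟩
      have := h.2.1 (pexp x) (pexp x')
      rw [← Real.exp_le_exp, exp_logMap, Real.exp_monotone.map_max]
      rw [← Subtype.coe_le_coe, coe_max] at this
      exact this
    · refine Or.inr ⟨eps_of_mem_classMinus h, fun x x' => ?_⟩
      have := h.2.1 (pexp x) (pexp x')
      rw [← Real.exp_le_exp, exp_logMap, Real.exp_monotone.map_min]
      rw [← Subtype.coe_le_coe, coe_min] at this
      exact this

lemma one_le_starMap_iff {F : PosFun} (h : F ∈ classH) (s z : ℝ) :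
    1 ≤ (starMap F (pexp (-s), pexp (-z)) : ℝ)
      ↔ 0 ≤ eps F * logMap F (-(eps F * s)) (-(eps F * z)) := by
  rcases h with h | h
  · rw [starMap, if_pos h, eps_of_mem_classPlus h, one_mul, one_mul, one_mul, ← exp_logMap,
      Real.one_le_exp_iff]
  · rw [starMap, if_neg (Set.disjoint_right.1 disjoint_classPlus_classMinus h),
      eps_of_mem_classMinus h, inversion]
    simp only [pexp_neg, inv_inv, neg_mul, one_mul, neg_neg]
    rw [show (((F (pexp s, pexp z))⁻¹ : PosReal) : ℝ) = ((F (pexp s, pexp z) : PosReal) : ℝ)⁻¹ from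
      rfl, ← exp_logMap, ← Real.exp_neg, Real.one_le_exp_iff]

/-- The set whose supremum is `T F s` is the half-line `(-∞, T F s]`. The limits in the definition
of the class make it bounded above. -/
lemma setOf_one_le_starMap {F : PosFun} (h : F ∈ classH) {s : ℝ} (hs : 0 < s) :
    {z : ℝ | 1 ≤ (starMap F (pexp (-s), pexp (-z)) : ℝ)} = Set.Iic (T F s) ∧ 0 ≤ T F s := by
  set Z := {z : ℝ | 1 ≤ (starMap F (pexp (-s), pexp (-z)) : ℝ)} with hZ
  have hg := isLogMap_logMap h
  have hZ' : Z = {z | 0 ≤ eps F * logMap F (-(eps F * s)) (-(eps F * z))} := by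
    ext z
    exact one_le_starMap_iff h s z
  have hclosed : IsClosed Z := by
    rw [hZ']
    exact isClosed_le continuous_const
      (continuous_const.mul ((hg.continuous_right _).comp (by fun_prop)))
  have h0 : (0 : ℝ) ∈ Z := by
    rw [hZ']
    rcases hg.sign with ⟨h1, h2⟩ | ⟨h1, h2⟩
    · have := (le_max_right _ _).trans (h2 (-s) 0)
      simpa [h1] using this
    · have := (h2 s 0).trans (min_le_right _ _)
      simpa [h1] using this
  have hlower : IsLowerSet Z := by
    rw [hZ']
    intro a b hab ha
    rcases hg.sign with ⟨h1, -⟩ | ⟨h1, -⟩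
    · have := hg.mono_right (-s) (neg_le_neg hab)
      simp only [h1, one_mul, Set.mem_ofPred_eq] at ha ⊢
      exact ha.trans this
    · have := hg.mono_right s hab
      simp only [h1, neg_mul, one_mul, neg_neg, Set.mem_ofPred_eq] at ha ⊢
      linarith
  have hbdd : BddAbove Z := by
    obtain ⟨b, hb⟩ : ∃ b, b ∉ Z := by
      rw [hZ']
      rcases h with h | h
      · have h1 := (h.2.2 (pexp (-s))).2
        have h2 : Tendsto (fun z : ℝ => pexp (-z)) atTop (comap Subtype.val (𝓝 (0 : ℝ))) :=
          tendsto_comap_iff.2 (Real.tendsto_exp_atBot.comp tendsto_neg_atTop_atBot)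
        have h3 : (pexp (-s) : ℝ) < 1 := by
          rw [← Real.exp_zero]
          exact Real.exp_lt_exp.2 (by linarith)
        obtain ⟨b, hb⟩ := (((continuous_subtype_val.tendsto _).comp (h1.comp h2)).eventually
          (gt_mem_nhds h3)).exists
        refine ⟨b, ?_⟩
        simp only [eps_of_mem_classPlus h, one_mul, Set.mem_ofPred_eq, not_le]
        exact Real.log_neg (F _).2 hb
      · have h1 := (h.2.2 (pexp s)).2
        have h2 : Tendsto pexp atTop atTop := by
          rw [tendsto_atTop]
          intro y
          filter_upwards [eventually_ge_atTop (Real.log (y : ℝ))] with x hx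
          rw [← pexp_log y]
          exact monotone_pexp hx
        have h3 : 1 < (pexp s : ℝ) := Real.one_lt_exp_iff.2 hs
        obtain ⟨b, hb⟩ := (((continuous_subtype_val.tendsto _).comp (h1.comp h2)).eventually
          (lt_mem_nhds h3)).exists
        refine ⟨b, ?_⟩
        simp only [eps_of_mem_classMinus h, one_mul, Set.mem_ofPred_eq, not_le, neg_mul, neg_neg,
          Left.neg_neg_iff]
        exact Real.log_pos hb
    exact ⟨b, fun z hz => le_of_not_gt fun hbz => hb (hlower hbz.le hz)⟩
  have hT : T F s = sSup Z := rfl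
  refine ⟨?_, hT ▸ le_csSup hbdd h0⟩
  rw [hT]
  exact Set.Subset.antisymm (fun z hz => le_csSup hbdd hz)
    (hlower.Iic_subset (hclosed.csSup_mem ⟨0, h0⟩ hbdd))

lemma T_nonneg {F : PosFun} (h : F ∈ classH) {s : ℝ} (hs : 0 < s) : 0 ≤ T F s :=
  (setOf_one_le_starMap h hs).2

lemma mem_crossing_iff {F : PosFun} (h : F ∈ classH) (s r : ℝ) :
    (s, r) ∈ crossing (logMap F) (eps F) ↔ s ∈ Set.Ioi 0 ∧ r ∈ Set.Ioc 0 (T F s) := by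
  constructor
  · rintro ⟨hs, hr, h1⟩
    rw [← one_le_starMap_iff h] at h1
    have : r ∈ {z : ℝ | 1 ≤ (starMap F (pexp (-s), pexp (-z)) : ℝ)} := h1
    rw [(setOf_one_le_starMap h hs).1] at this
    exact ⟨hs, hr, this⟩
  · rintro ⟨hs, hr, h1⟩
    have : r ∈ Set.Iic (T F s) := h1
    rw [← (setOf_one_le_starMap h hs).1] at this
    exact ⟨hs, hr, (one_le_starMap_iff h s r).1 this⟩

lemma measurableSet_crossing_logMap {F : PosFun} (h : F ∈ classH) :
    MeasurableSet (crossing (logMap F) (eps F)) :=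
  IsLogMap.measurableSet_crossing (isHomogeneous_of_mem_classH h).continuous_logMap.measurable

lemma lintegral_crossing {F : PosFun} (h : F ∈ classH) {φ : ℝ × ℝ → ENNReal} (hφ : Measurable φ) :
    ∫⁻ q in crossing (logMap F) (eps F), φ q
      = ∫⁻ s in Set.Ioi (0 : ℝ), ∫⁻ r in Set.Ioc 0 (T F s), φ (s, r) := by
  have hm := measurableSet_crossing_logMap h
  rw [← lintegral_indicator hm, Measure.volume_eq_prod,
    lintegral_prod _ (hφ.indicator hm).aemeasurable, ← lintegral_indicator measurableSet_Ioi]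
  congr 1
  ext s
  by_cases hs : s ∈ Set.Ioi (0 : ℝ)
  · rw [Set.indicator_of_mem hs, ← lintegral_indicator measurableSet_Ioc]
    congr 1
    ext r
    by_cases hr : r ∈ Set.Ioc 0 (T F s)
    · rw [Set.indicator_of_mem hr, Set.indicator_of_mem ((mem_crossing_iff h s r).2 ⟨hs, hr⟩)]
    · rw [Set.indicator_of_notMem hr,
        Set.indicator_of_notMem fun h' => hr ((mem_crossing_iff h s r).1 h').2]
  · rw [Set.indicator_of_notMem hs, lintegral_eq_zero_of_ae_eq_zero]
    filter_upwards with r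
    exact Set.indicator_of_notMem (fun h' => hs ((mem_crossing_iff h s r).1 h').1) _

lemma Gam_one_eq {F : PosFun} (h : F ∈ classH) (a : ℝ) :
    Gam a 1 F = ∫⁻ q in crossing (logMap F) (eps F), ENNReal.ofReal (q.1 ^ a) := by
  rw [lintegral_crossing h (by fun_prop), Gam]
  refine setLIntegral_congr_fun measurableSet_Ioi fun s hs => ?_
  simp only [lintegral_const, Measure.restrict_apply_univ, Real.volume_Ioc, sub_zero, Real.rpow_one]
  rw [ENNReal.ofReal_mul (Real.rpow_nonneg (le_of_lt hs) a)]

lemma Gam_zero_eq {F : PosFun} (h : F ∈ classH) {b : ℝ} (hb : 0 ≤ b) :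
    Gam 0 (b + 1) F
      = ∫⁻ q in crossing (logMap F) (eps F), ENNReal.ofReal ((b + 1) * q.2 ^ b) := by
  rw [lintegral_crossing h (by fun_prop), Gam]
  refine setLIntegral_congr_fun measurableSet_Ioi fun s hs => ?_
  have hT := T_nonneg h hs
  have hi : IntervalIntegrable (fun r : ℝ => (b + 1) * r ^ b) volume 0 (T F s) :=
    (intervalIntegral.intervalIntegrable_rpow' (by linarith)).const_mul _
  simp only
  rw [← ofReal_integral_eq_lintegral_ofReal
    ((intervalIntegrable_iff_integrableOn_Ioc_of_le hT).1 hi),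
    ← intervalIntegral.integral_of_le hT, intervalIntegral.integral_const_mul,
    integral_rpow (Or.inl (by linarith)), Real.zero_rpow (by linarith), Real.rpow_zero, one_mul,
    sub_zero, mul_div_cancel₀ _ (by linarith : b + 1 ≠ 0)]
  filter_upwards [ae_restrict_mem measurableSet_Ioc] with r hr
  exact mul_nonneg (by linarith) (Real.rpow_nonneg hr.1.le b)

/-- Apart from `max` and `min`, every function of the class has a nontrivial crossing region. -/
lemma volume_crossing_pos {F : PosFun} (h : F ∈ classH)
    (hF : F ∉ ({phiPlus, phiMinus} : Set PosFun)) :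
    0 < volume (crossing (logMap F) (eps F)) := by
  have hg := isLogMap_logMap h
  have hext : ∀ F' : PosFun, (∀ x x', logMap F x x' = logMap F' x x') → F = F' := by
    intro F' h'
    funext q
    have := h' (Real.log (q.1 : ℝ)) (Real.log (q.2 : ℝ))
    rw [← Real.exp_eq_exp, exp_logMap, exp_logMap, pexp_log, pexp_log] at this
    exact Subtype.ext this
  simp only [Set.mem_insert_iff, Set.mem_singleton_iff, not_or] at hF
  -- a rectangle inside the crossing region
  obtain ⟨a, b, ha, hb, hab⟩ : ∃ a b : ℝ, 0 < a ∧ 0 < b ∧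
      Set.Ioo 0 a ×ˢ Set.Ioo 0 b ⊆ crossing (logMap F) (eps F) := by
    rcases hg.sign with ⟨h1, h2⟩ | ⟨h1, h2⟩
    · obtain ⟨x, x', hx⟩ : ∃ x x', max x x' < logMap F x x' := by
        by_contra! hc
        refine hF.1 (hext _ fun x x' => ((hc x x').antisymm (h2 x x')).trans ?_)
        rw [← Real.exp_eq_exp, exp_logMap, phiPlus, coe_max, Real.exp_monotone.map_max]
        rfl
      have h3 := hg.add (-logMap F x x') x x'
      rw [neg_add_cancel] at h3
      obtain ⟨h4, h5⟩ := max_lt_iff.1 hx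
      refine ⟨logMap F x x' - x, logMap F x x' - x', by linarith, by linarith, ?_⟩
      rintro ⟨s, r⟩ ⟨hs, hr⟩
      refine ⟨hs.1, hr.1, ?_⟩
      have h6 := hg.mono_left (-logMap F x x' + x')
        (show -logMap F x x' + x ≤ -s by linarith [hs.2])
      have h7 := hg.mono_right (-s) (show -logMap F x x' + x' ≤ -r by linarith [hr.2])
      simp only [h1, one_mul] at h6 h7 ⊢
      linarith
    · obtain ⟨x, x', hx⟩ : ∃ x x', logMap F x x' < min x x' := by
        by_contra! hc
        refine hF.2 (hext _ fun x x' => ((h2 x x').antisymm (hc x x')).trans ?_)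
        rw [← Real.exp_eq_exp, exp_logMap, phiMinus, coe_min, Real.exp_monotone.map_min]
        rfl
      have h3 := hg.add (-logMap F x x') x x'
      rw [neg_add_cancel] at h3
      obtain ⟨h4, h5⟩ := lt_min_iff.1 hx
      refine ⟨x - logMap F x x', x' - logMap F x x', by linarith, by linarith, ?_⟩
      rintro ⟨s, r⟩ ⟨hs, hr⟩
      refine ⟨hs.1, hr.1, ?_⟩
      have h6 := hg.mono_left (-logMap F x x' + x')
        (show s ≤ -logMap F x x' + x by linarith [hs.2])
      have h7 := hg.mono_right s (show r ≤ -logMap F x x' + x' by linarith [hr.2])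
      simp only [h1, neg_mul, one_mul, neg_neg] at h6 h7 ⊢
      linarith
  refine lt_of_lt_of_le ?_ (measure_mono hab)
  rw [Measure.volume_eq_prod, Measure.prod_prod, Real.volume_Ioo, Real.volume_Ioo, sub_zero,
    sub_zero]
  exact ENNReal.mul_pos (ENNReal.ofReal_pos.2 ha).ne' (ENNReal.ofReal_pos.2 hb).ne'

/-! ### Random homogeneous functions -/

section Random

variable {Ω : Type*} [MeasurableSpace Ω] {P : Measure Ω} {F : Ω → PosFun}

lemma isRandomLogMap_logMap (hF : Measurable F) (hH : ∀ ω, F ω ∈ classH) :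
    IsRandomLogMap (fun ω => logMap (F ω)) (fun ω => eps (F ω)) where
  measurable := by
    have h1 : Measurable (Function.uncurry fun (q : PosReal × PosReal) (ω : Ω) => F ω q) :=
      measurable_uncurry_of_continuous_of_measurable
        (fun ω => (isHomogeneous_of_mem_classH (hH ω)).continuous)
        (fun q => (measurable_pi_apply q).comp hF)
    have h2 : Measurable fun z : Ω × ℝ × ℝ => ((pexp z.2.1, pexp z.2.2), z.1) :=
      ((continuous_pexp.measurable.comp measurable_snd.fst).prodMk
        (continuous_pexp.measurable.comp measurable_snd.snd)).prodMk measurable_fst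
    exact Real.measurable_log.comp (measurable_subtype_coe.comp (h1.comp h2))
  measurable_sign := by
    -- on the class, the sign is read off from the value at one point off the diagonal
    have h1 : ∀ ω, eps (F ω) = if pexp 1 ≤ F ω (pexp 0, pexp 1) then 1 else -1 := by
      intro ω
      rcases hH ω with h | h
      · rw [eps_of_mem_classPlus h, if_pos]
        exact (le_max_right _ _).trans (h.2.1 _ _)
      · rw [eps_of_mem_classMinus h, if_neg]
        rw [not_le]
        refine ((h.2.1 _ _).trans (min_le_left _ _)).trans_lt ?_
        exact Real.exp_lt_exp.2 one_pos
    simp_rw [h1]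
    exact Measurable.ite (measurableSet_le measurable_const ((measurable_pi_apply _).comp hF))
      measurable_const measurable_const
  isLogMap ω := isLogMap_logMap (hH ω)

lemma lintegral_crossingMeasure [SFinite P] (hF : Measurable F) (hH : ∀ ω, F ω ∈ classH)
    {φ : ℝ × ℝ → ENNReal} (hφ : Measurable φ) :
    ∫⁻ z, φ z.2 ∂(crossingMeasure P (fun ω => logMap (F ω)) (fun ω => eps (F ω)))
      = ∫⁻ ω, (∫⁻ q in crossing (logMap (F ω)) (eps (F ω)), φ q) ∂P := by
  have hS := (isRandomLogMap_logMap hF hH).measurableSet_crossing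
  have hm : Measurable fun z : Ω × ℝ × ℝ => φ z.2 := hφ.comp measurable_snd
  rw [crossingMeasure, ← lintegral_indicator hS, lintegral_prod _ (hm.indicator hS).aemeasurable]
  congr 1
  ext ω
  rw [← lintegral_indicator (measurableSet_crossing_logMap (hH ω))]
  rfl

variable [IsProbabilityMeasure P]

lemma isBalanced_logMap (hF : Measurable F) (hH : ∀ ω, F ω ∈ classH)
    (heps : ∫ ω, eps (F ω) ∂P = 0) (hGam : ∫ ω, (Gam 0 1 (F ω)).toReal * eps (F ω) ∂P = 0)
    {η : ℝ} (hη : 0 < η) (hmom₁ : ∫⁻ ω, Gam (1 + η) 1 (F ω) ∂P < ⊤)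
    (hmom₂ : ∫⁻ ω, Gam 0 (2 + η) (F ω) ∂P < ⊤) :
    IsBalanced P (fun ω => logMap (F ω)) (fun ω => eps (F ω)) (min (1 + η) 2) := by
  have hR := isRandomLogMap_logMap hF hH
  set lam := crossingMeasure P (fun ω => logMap (F ω)) (fun ω => eps (F ω)) with hlam
  have hpos : ∀ᵐ z ∂lam, 0 < z.2.1 ∧ 0 < z.2.2 := hR.ae_crossingMeasure
  have h1 : ∫⁻ z, ENNReal.ofReal (z.2.1 ^ (1 + η)) ∂lam < ⊤ := by
    rw [hlam, lintegral_crossingMeasure hF hH (φ := fun q => ENNReal.ofReal (q.1 ^ (1 + η)))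
      (by fun_prop)]
    simpa only [Gam_one_eq (hH _)] using hmom₁
  have h2 : ∫⁻ z, ENNReal.ofReal ((1 + η + 1) * z.2.2 ^ (1 + η)) ∂lam < ⊤ := by
    rw [hlam, lintegral_crossingMeasure hF hH
      (φ := fun q => ENNReal.ofReal ((1 + η + 1) * q.2 ^ (1 + η))) (by fun_prop)]
    rw [show 2 + η = 1 + η + 1 by ring] at hmom₂
    simpa only [Gam_zero_eq (hH _) (show 0 ≤ 1 + η by linarith)] using hmom₂
  have hfin : IsFiniteMeasure lam := by
    -- the unit square has mass at most one, and the moments control its complement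
    refine ⟨?_⟩
    set U : Set (Ω × ℝ × ℝ) := Set.univ ×ˢ (Set.Icc 0 1 ×ˢ Set.Icc 0 1) with hU
    have hUm : MeasurableSet U :=
      MeasurableSet.univ.prod (measurableSet_Icc.prod measurableSet_Icc)
    have hU1 : lam U ≤ 1 := by
      refine (Measure.restrict_apply_le _ _).trans ?_
      rw [hU, Measure.prod_prod, Measure.volume_eq_prod, Measure.prod_prod]
      simp
    have hle : lam Set.univ ≤ lam U + (∫⁻ z, ENNReal.ofReal (z.2.1 ^ (1 + η)) ∂lam
        + ∫⁻ z, ENNReal.ofReal ((1 + η + 1) * z.2.2 ^ (1 + η)) ∂lam) := by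
      rw [← lintegral_add_left (by fun_prop), ← lintegral_indicator_one hUm,
        ← lintegral_add_left (measurable_one.indicator hUm), ← lintegral_one]
      apply lintegral_mono_ae
      filter_upwards [hpos] with z hz
      by_cases hzU : z ∈ U
      · rw [Set.indicator_of_mem hzU]
        exact le_self_add
      · rw [Set.indicator_of_notMem hzU, zero_add, ← ENNReal.ofReal_add
          (Real.rpow_nonneg hz.1.le _)
          (mul_nonneg (by linarith) (Real.rpow_nonneg hz.2.le _)), ENNReal.one_le_ofReal]
        have hs := Real.rpow_nonneg hz.1.le (1 + η)
        have hr := Real.rpow_nonneg hz.2.le (1 + η)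
        rcases le_or_gt z.2.1 1 with h3 | h3
        · have h4 : 1 < z.2.2 := by
            by_contra! h4
            exact hzU ⟨trivial, ⟨hz.1.le, h3⟩, ⟨hz.2.le, h4⟩⟩
          have := Real.one_le_rpow h4.le (show 0 ≤ 1 + η by linarith)
          nlinarith
        · have := Real.one_le_rpow h3.le (show 0 ≤ 1 + η by linarith)
          nlinarith
    exact hle.trans_lt (ENNReal.add_lt_top.2 ⟨hU1.trans_lt ENNReal.one_lt_top,
      ENNReal.add_lt_top.2 ⟨h1, h2⟩⟩)
  have hσ : Integrable (fun z : Ω × ℝ × ℝ => eps (F z.1)) lam :=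
    Integrable.of_bound (hR.measurable_sign.comp measurable_fst).aestronglyMeasurable 1
      (ae_of_all _ fun z => (hR.abs_sign z.1).le)
  refine ⟨lt_min (by linarith) one_lt_two, min_le_right _ _, heps, hfin, ?_, ?_⟩
  · rw [(hR.integral_crossingMeasure hσ).2, ← hGam]
    congr 1
    ext ω
    simp only
    rw [setIntegral_const, smul_eq_mul, Gam_one_eq (hH ω)]
    simp [measureReal_def]
  · have i1 : Integrable (fun z : Ω × ℝ × ℝ => z.2.1 ^ (1 + η)) lam := by
      refine ⟨(by fun_prop : Measurable fun z : Ω × ℝ × ℝ =>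
        z.2.1 ^ (1 + η)).aestronglyMeasurable, ?_⟩
      rw [hasFiniteIntegral_iff_ofReal]
      · exact h1
      · filter_upwards [hpos] with z hz using Real.rpow_nonneg hz.1.le _
    have i2 : Integrable (fun z : Ω × ℝ × ℝ => (1 + η + 1) * z.2.2 ^ (1 + η)) lam := by
      refine ⟨(by fun_prop : Measurable fun z : Ω × ℝ × ℝ =>
        (1 + η + 1) * z.2.2 ^ (1 + η)).aestronglyMeasurable, ?_⟩
      rw [hasFiniteIntegral_iff_ofReal]
      · exact h2
      · filter_upwards [hpos] with z hz
        exact mul_nonneg (by linarith) (Real.rpow_nonneg hz.2.le _)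
    refine ((integrable_const (2 : ℝ)).add (i1.add i2)).mono' (by fun_prop : Measurable
      fun z : Ω × ℝ × ℝ => z.2.1 ^ (min (1 + η) 2) + z.2.2 ^ (min (1 + η) 2)).aestronglyMeasurable ?_
    filter_upwards [hpos] with z hz
    have key : ∀ x : ℝ, 0 < x → x ^ (min (1 + η) 2) ≤ 1 + x ^ (1 + η) := by
      intro x hx
      rcases le_total x 1 with h3 | h3
      · have := Real.rpow_le_one hx.le h3 (show 0 ≤ min (1 + η) 2 by positivity)
        linarith [Real.rpow_nonneg hx.le (1 + η)]
      · have := Real.rpow_le_rpow_of_exponent_le h3 (min_le_left (1 + η) 2)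
        linarith
    have e1 := Real.rpow_nonneg hz.1.le (min (1 + η) 2)
    have e2 := Real.rpow_nonneg hz.2.le (min (1 + η) 2)
    have e3 := Real.rpow_nonneg hz.2.le (1 + η)
    rw [Real.norm_of_nonneg (by linarith)]
    simp only [Pi.add_apply]
    nlinarith [key _ hz.1, key _ hz.2]

/-- The constant of the theorem is `9 / 2` times the mean of `s + r` under the crossing measure. -/
lemma cstar_eq (hF : Measurable F) (hH : ∀ ω, F ω ∈ classH) {p : ℝ}
    (hb : IsBalanced P (fun ω => logMap (F ω)) (fun ω => eps (F ω)) p) :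
    cstar P F = ENNReal.ofReal (9 / 2 * ∫ z, (z.2.1 + z.2.2)
      ∂(crossingMeasure P (fun ω => logMap (F ω)) (fun ω => eps (F ω)))) := by
  have hR := isRandomLogMap_logMap hF hH
  have hGam : ∀ ω, Gam 0 2 (F ω) + 2 * Gam 1 1 (F ω)
      = ∫⁻ q in crossing (logMap (F ω)) (eps (F ω)), ENNReal.ofReal (2 * (q.1 + q.2)) := by
    intro ω
    rw [show (2 : ℝ) = 1 + 1 by norm_num, Gam_zero_eq (hH ω) zero_le_one, Gam_one_eq (hH ω),
      ← lintegral_const_mul _ (by fun_prop), ← lintegral_add_left (by fun_prop)]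
    refine setLIntegral_congr_fun (measurableSet_crossing_logMap (hH ω)) fun q hq => ?_
    have h1 : (0 : ℝ) ≤ q.1 := hq.1.le
    have h2 : (0 : ℝ) ≤ q.2 := hq.2.1.le
    simp only [Real.rpow_one]
    rw [show (2 : ENNReal) = ENNReal.ofReal (1 + 1) by norm_num, ← ENNReal.ofReal_mul (by norm_num),
      ← ENNReal.ofReal_add (by positivity) (by positivity)]
    congr 1
    ring
  rw [cstar]
  simp_rw [hGam]
  rw [← lintegral_crossingMeasure hF hH (φ := fun q => ENNReal.ofReal (2 * (q.1 + q.2)))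
    (by fun_prop), ← ofReal_integral_eq_lintegral_ofReal
    ((hR.integrable_fst_add_snd hb).const_mul 2), integral_const_mul]
  · rw [show (9 / 4 : ENNReal) = ENNReal.ofReal (9 / 4) by
      rw [ENNReal.ofReal_div_of_pos (by norm_num)]; norm_num,
      ← ENNReal.ofReal_mul (by norm_num)]
    congr 1
    ring
  · filter_upwards [hR.ae_crossingMeasure] with z hz
    simp only [Pi.zero_apply]
    linarith [hz.1, hz.2]

lemma integral_fst_add_snd_pos (hF : Measurable F) (hH : ∀ ω, F ω ∈ classH) {p : ℝ}
    (hb : IsBalanced P (fun ω => logMap (F ω)) (fun ω => eps (F ω)) p)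
    (hnontriv : 0 < P {ω | F ω ∉ ({phiPlus, phiMinus} : Set PosFun)}) :
    0 < ∫ z, (z.2.1 + z.2.2)
      ∂(crossingMeasure P (fun ω => logMap (F ω)) (fun ω => eps (F ω))) := by
  have hR := isRandomLogMap_logMap hF hH
  have hI := hR.integrable_fst_add_snd hb
  have hpos := hR.ae_crossingMeasure (P := P)
  rw [integral_pos_iff_support_of_nonneg_ae _ hI]
  · have hsupp : (Function.support fun z : Ω × ℝ × ℝ => z.2.1 + z.2.2)
        =ᵐ[crossingMeasure P (fun ω => logMap (F ω)) (fun ω => eps (F ω))] Set.univ := by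
      rw [eventuallyEq_univ]
      filter_upwards [hpos] with z hz
      exact (add_pos hz.1 hz.2).ne'
    rw [measure_congr hsupp, ← lintegral_one,
      lintegral_crossingMeasure hF hH (φ := fun _ => 1) measurable_const, pos_iff_ne_zero]
    intro h0
    rw [lintegral_eq_zero_iff' ?_] at h0
    · refine hnontriv.ne' (measure_mono_null ?_ (ae_iff.1 h0))
      intro ω hω
      have := volume_crossing_pos (hH ω) hω
      simpa using this.ne'
    · have := measurable_measure_prodMk_left (ν := (volume : Measure (ℝ × ℝ)))
        hR.measurableSet_crossing
      simp only [lintegral_one, Measure.restrict_apply_univ]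
      exact this.aemeasurable
  · filter_upwards [hpos] with z hz
    exact (add_pos hz.1 hz.2).le

lemma tendsto_of_forall_mem_classH {Ω' : Type*} [MeasurableSpace Ω'] {Q : Measure Ω'}
    [IsProbabilityMeasure Q] (hF : Measurable F) (hH : ∀ ω, F ω ∈ classH)
    {X : ℕ → Ω' → PosReal} (hX : ∀ n, Measurable (X n)) (hsys : IsSystem P F Q X)
    (hnontriv : 0 < P {ω | F ω ∉ ({phiPlus, phiMinus} : Set PosFun)})
    (heps : ∫ ω, eps (F ω) ∂P = 0) (hGam : ∫ ω, (Gam 0 1 (F ω)).toReal * eps (F ω) ∂P = 0)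
    {η : ℝ} (hη : 0 < η) (hmom₁ : ∫⁻ ω, Gam (1 + η) 1 (F ω) ∂P < ⊤)
    (hmom₂ : ∫⁻ ω, Gam 0 (2 + η) (F ω) ∂P < ⊤) :
    (0 < cstar P F ∧ cstar P F < ⊤) ∧
    ∀ y : ℝ, Tendsto (fun n : ℕ => Q.real {w | Real.log (X n w : ℝ) /
        ((cstar P F).toReal * (n : ℝ)) ^ (1 / 3 : ℝ) ≤ y})
      atTop (𝓝 (∫ x in Set.Iic y, limitDensity x)) := by
  have hR := isRandomLogMap_logMap hF hH
  have hb := isBalanced_logMap hF hH heps hGam hη hmom₁ hmom₂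
  have hm0 := integral_fst_add_snd_pos hF hH hb hnontriv
  have hc := cstar_eq hF hH hb
  set m := ∫ z, (z.2.1 + z.2.2)
      ∂(crossingMeasure P (fun ω => logMap (F ω)) (fun ω => eps (F ω))) with hm
  refine ⟨?_, fun y => ?_⟩
  · rw [hc]
    exact ⟨ENNReal.ofReal_pos.2 (by positivity), ENNReal.ofReal_lt_top⟩
  have hlog : ∀ n, Measurable fun w => Real.log (X n w : ℝ) := fun n =>
    Real.measurable_log.comp (measurable_subtype_coe.comp (hX n))
  have hprob : ∀ n, IsProbabilityMeasure (Q.map fun w => Real.log (X n w : ℝ)) := fun n =>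
    Measure.isProbabilityMeasure_map (hlog n).aemeasurable
  have hrec : ∀ n, (Q.map fun w => Real.log (X (n + 1) w : ℝ))
      = (P.prod ((Q.map fun w => Real.log (X n w : ℝ)).prod
        (Q.map fun w => Real.log (X n w : ℝ)))).map fun z => logMap (F z.1) z.2.1 z.2.2 := by
    intro n
    have hmp : MeasurePreserving
        (fun z : Ω × Ω' × Ω' => (z.1, Real.log (X n z.2.1 : ℝ), Real.log (X n z.2.2 : ℝ)))
        (P.prod (Q.prod Q)) (P.prod ((Q.map fun w => Real.log (X n w : ℝ)).prod
        (Q.map fun w => Real.log (X n w : ℝ)))) := by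
      have h1 : MeasurePreserving (fun w => Real.log (X n w : ℝ)) Q
        (Q.map fun w => Real.log (X n w : ℝ)) := ⟨hlog n, rfl⟩
      exact (MeasurePreserving.id P).prod (h1.prod h1)
    have hval : Measurable fun x : PosReal => Real.log (x : ℝ) :=
      Real.measurable_log.comp measurable_subtype_coe
    rw [← hmp.map_eq, Measure.map_map hR.measurable hmp.measurable]
    have h2 := ((hsys n).comp hval).map_eq
    refine h2.trans ?_
    congr 1
    funext z
    simp only [Function.comp_apply, logMap, pexp_log]
  have hT := hR.tendsto_measureReal_Iic hb hm hm0
    (μ := fun n => Q.map fun w => Real.log (X n w : ℝ)) hrec y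
  rw [integral_Iic_limitDensity]
  refine hT.congr' ?_
  filter_upwards [eventually_gt_atTop 0] with n hn
  have hn0 : (0 : ℝ) < n := by exact_mod_cast hn
  rw [map_measureReal_apply (hlog n) measurableSet_Iic, hc,
    ENNReal.toReal_ofReal (by positivity)]
  congr 1
  ext w
  simp only [Set.mem_preimage, Set.mem_Iic, Set.mem_ofPred_eq]
  rw [div_le_iff₀ (by positivity)]

end Random

end HomSystem

theorem theorem1p6 {Ω Ω' : Type*} [MeasurableSpace Ω] [MeasurableSpace Ω']
    (P : Measure Ω) [IsProbabilityMeasure P] (Q : Measure Ω') [IsProbabilityMeasure Q]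
    (F : Ω → HomSystem.PosFun) (hF : Measurable F)
    (X : ℕ → Ω' → HomSystem.PosReal) (hX : ∀ n, Measurable (X n))
    (hsys : HomSystem.IsSystem P F Q X)
    (hH : ∀ᵐ ω ∂P, F ω ∈ HomSystem.classH)
    (hnontriv : 0 < P {ω | F ω ∉ ({HomSystem.phiPlus, HomSystem.phiMinus} : Set HomSystem.PosFun)})
    (heps : ∫ ω, HomSystem.eps (F ω) ∂P = 0)
    (hGam : ∫ ω, (HomSystem.Gam 0 1 (F ω)).toReal * HomSystem.eps (F ω) ∂P = 0)
    (hmom : ∃ η : ℝ, 0 < η ∧ ∫⁻ ω, HomSystem.Gam (1 + η) 1 (F ω) ∂P < ⊤ ∧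
      ∫⁻ ω, HomSystem.Gam 0 (2 + η) (F ω) ∂P < ⊤) :
    (0 < HomSystem.cstar P F ∧ HomSystem.cstar P F < ⊤) ∧
    ∀ y : ℝ, Tendsto
      (fun n : ℕ => Q.real {w | Real.log (X n w : ℝ) /
        ((HomSystem.cstar P F).toReal * (n : ℝ)) ^ (1 / 3 : ℝ) ≤ y})
      atTop (𝓝 (∫ x in Set.Iic y, HomSystem.limitDensity x)) := by
  classical
  obtain ⟨η, hη, hmom₁, hmom₂⟩ := hmom
  -- replace `F` on a null set by a fixed element of the class
  obtain ⟨ω₀, hω₀⟩ := hH.exists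
  set N := toMeasurable P {ω | F ω ∉ HomSystem.classH} with hN
  have hN0 : P N = 0 := by
    rw [hN, measure_toMeasurable]
    exact ae_iff.1 hH
  have hNm : MeasurableSet N := measurableSet_toMeasurable _ _
  set F' : Ω → HomSystem.PosFun := fun ω => if ω ∈ N then F ω₀ else F ω with hF'def
  have hF' : Measurable F' := Measurable.ite hNm measurable_const hF
  have hH' : ∀ ω, F' ω ∈ HomSystem.classH := by
    intro ω
    by_cases hω : ω ∈ N
    · have h1 : F' ω = F ω₀ := if_pos hω
      rwa [h1]
    · have h1 : F' ω = F ω := if_neg hω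
      rw [h1]
      by_contra h2
      exact hω (subset_toMeasurable _ _ h2)
  have hae : ∀ᵐ ω ∂P, F ω = F' ω := by
    filter_upwards [measure_eq_zero_iff_ae_notMem.1 hN0] with ω hω
    exact (if_neg hω).symm
  have hc : HomSystem.cstar P F = HomSystem.cstar P F' := by
    rw [HomSystem.cstar, HomSystem.cstar]
    congr 1
    apply lintegral_congr_ae
    filter_upwards [hae] with ω hω
    rw [hω]
  rw [hc]
  refine HomSystem.tendsto_of_forall_mem_classH hF' hH' hX ?_ ?_ ?_ ?_ hη ?_ ?_
  · intro n
    have hfst : ∀ᵐ z ∂(P.prod (Q.prod Q)), F z.1 = F' z.1 :=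
      Measure.quasiMeasurePreserving_fst.ae hae
    have heq : (fun z : Ω × Ω' × Ω' => F z.1 (X n z.2.1, X n z.2.2))
        =ᵐ[P.prod (Q.prod Q)] fun z => F' z.1 (X n z.2.1, X n z.2.2) := by
      filter_upwards [hfst] with z hz
      rw [hz]
    exact ⟨(hsys n).aemeasurable_fst, (hsys n).aemeasurable_snd.congr heq,
      (hsys n).map_eq.trans (Measure.map_congr heq)⟩
  · refine hnontriv.trans_eq (measure_congr ?_)
    filter_upwards [hae] with ω hω
    exact congrArg (fun f => f ∉ ({HomSystem.phiPlus, HomSystem.phiMinus} : Set HomSystem.PosFun)) hω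
  · rw [← heps]
    apply integral_congr_ae
    filter_upwards [hae] with ω hω
    rw [hω]
  · refine (integral_congr_ae ?_).trans hGam
    filter_upwards [hae] with ω hω
    rw [hω]
  · refine lt_of_eq_of_lt (lintegral_congr_ae ?_) hmom₁
    filter_upwards [hae] with ω hω
    rw [hω]
  · refine lt_of_eq_of_lt (lintegral_congr_ae ?_) hmom₂
    filter_upwards [hae] with ω hω
    rw [hω]
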